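/- Let $\kappa>0$, $R>0$ and $B_R=\{x\in\mathbb R^3:|x|<R\}$. Let $$g(x,y)=\frac{e^{\mathrm i\kappa|x-y|}}{4\pi|x-y|},\qquad \boldsymbol G(x,y)=\big(\boldsymbol I+\kappa^{-2}\nabla_y\nabla_y\big)g(x,y)$$ be the Green's function of the Helmholtz equation and the dyadic Green's tensor of Maxwell's equations. A source $\boldsymbol J\in (L^2(B_R))^3$ (complex valued, regarded as zero outside $B_R$) generates the electric field $$\boldsymbol E(x)=\int_{B_R}\boldsymbol G(x,y)\boldsymbol J(y)\,\mathrm dy,$$ and it is called nonradiating if $\boldsymbol E(x)=0$ for all $|x|>R$. For $n=0,1,2,\dots$ and $m=-n,\dots,n$ put $$\alpha_n^m=\int_{B_R}j_n(\kappa|y|)\overline{Y_n^m(\hat y)}\,\boldsymbol J(y)\,\mathrm dy,\qquad \beta_n^m=\int_{B_R}\Big(\big(\boldsymbol I+\kappa^{-2}\nabla_y\nabla_y\big)\big(j_n(\kappa|y|)\overline{Y_n^m(\hat y)}\big)\Big)\boldsymbol J(y)\,\mathrm dy,$$ where $\hat y=y/|y|$, $j_n$ is the spherical Bessel function of order $n$,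 and $$Y_n^m(\theta,\phi)=\sqrt{\frac{(2n+1)(n-|m|)!}{4\pi(n+|m|)!}}\,(1-t^2)^{|m|/2}\frac{\mathrm d^{|m|}P_n}{\mathrm dt^{|m|}}(t)\Big|_{t=\cos\theta}e^{\mathrm im\phi}$$ are the spherical harmonics, with $P_n$ the Legendre polynomial of degree $n$. **Proposition 3.2.** Suppose that $\nabla\cdot\boldsymbol J=0$ in the sense of distributions on $\mathbb R^3$, where $\boldsymbol J$ is extended by zero outside $B_R$ (if $\boldsymbol J$ has compact support in the open ball $B_R$, this is the same as $\nabla\cdot\boldsymbol J=0$ in the sense of distributions on $B_R$). Then $\beta_n^m=\alpha_n^m$ for all $n=0,1,\dots$ and $m=-n,\dots,n$, and $\boldsymbol J$ is nonradiating if and only if $\alpha_n^m=0$ for all $n=0,1,\dots$ and $m=-n,\dots,n$. -/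

import Mathlib

open MeasureTheory
open scoped ContDiff Nat

noncomputable section

namespace Maxwell

/-- Physical space `ℝ³` with the Euclidean norm. -/
abbrev E3 : Type := EuclideanSpace ℝ (Fin 3)

/-- Complex vectors `ℂ³`, the values of fields and sources. -/
abbrev C3 : Type := EuclideanSpace ℂ (Fin 3)

/-- The open ball `B_R = {x : |x| < R}`. -/
def ballR (R : ℝ) : Set E3 := Metric.ball (0 : E3) R

/-- The partial derivative `∂f/∂y_i` of a complex function on `ℝ³`. -/
def pderiv (i : Fin 3) (f : E3 → ℂ) (y : E3) : ℂ :=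
  fderiv ℝ f y (EuclideanSpace.single i 1)

/-- The `3 × 3` matrix `(I + κ⁻² ∇∇) f` at the point `y`. -/
def dyad (κ : ℝ) (f : E3 → ℂ) (y : E3) : Matrix (Fin 3) (Fin 3) ℂ :=
  Matrix.of fun l s =>
    (if l = s then f y else 0) + ((κ : ℂ) ^ 2)⁻¹ * pderiv l (pderiv s f) y

/-- The outgoing fundamental solution `g(x, y) = exp(iκ|x - y|) / (4π|x - y|)` of the Helmholtz
equation. -/
def helmholtzGreen (κ : ℝ) (x y : E3) : ℂ :=
  Complex.exp (Complex.I * κ * ‖x - y‖) / (4 * Real.pi * ‖x - y‖)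

/-- The dyadic Green's tensor `G(x, y) = (I + κ⁻² ∇_y ∇_y) g(x, y)` of Maxwell's equations. -/
def dyadicGreen (κ : ℝ) (x y : E3) : Matrix (Fin 3) (Fin 3) ℂ :=
  dyad κ (helmholtzGreen κ x) y

/-- The electric field `E(x) = ∫_{B_R} G(x, y) J(y) dy`, by components. -/
def electricField (κ R : ℝ) (J : E3 → C3) (x : E3) : Fin 3 → ℂ := fun l =>
  ∫ y in ballR R, ∑ s, dyadicGreen κ x y l s * J y s

/-- `J` is nonradiating: the field that it generates vanishes for `|x| > R`. -/
def IsNonradiating (κ R : ℝ) (J : E3 → C3) : Prop :=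
  ∀ x : E3, R < ‖x‖ → electricField κ R J x = 0

/-- The spherical Bessel function `j_n`, by its (everywhere convergent) power series
`j_n(t) = tⁿ ∑_k (-t²/2)^k / (k! (2n+2k+1)!!)`. -/
def sphBessel (n : ℕ) (t : ℝ) : ℝ :=
  t ^ n * ∑' k : ℕ, (-(t ^ 2) / 2) ^ k / ((k ! : ℝ) * ((2 * n + 2 * k + 1)‼ : ℝ))

/-- The Legendre polynomial `P_n`, by Rodrigues' formula. -/
def legendreP (n : ℕ) : Polynomial ℝ :=
  Polynomial.C (((2 : ℝ) ^ n * (n ! : ℝ))⁻¹) *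
    (Polynomial.derivative^[n] ((Polynomial.X ^ 2 - 1) ^ n))

/-- The normalising constant `N_n^m = √((2n+1) (n-|m|)! / (4π (n+|m|)!))`, used for `|m| ≤ n`. -/
def sphNorm (n : ℕ) (m : ℤ) : ℝ :=
  Real.sqrt ((2 * n + 1) * ((n - m.natAbs) ! : ℝ) / (4 * Real.pi * ((n + m.natAbs) ! : ℝ)))

/-- The spherical harmonic `Y_n^m(θ, φ) = N_n^m P_n^{|m|}(cos θ) e^{imφ}`, where
`P_n^{|m|}(t) = (1 - t²)^{|m|/2} (d/dt)^{|m|} P_n(t)`, at the point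
`u = (sin θ cos φ, sin θ sin φ, cos θ)` of the unit sphere. In Cartesian coordinates the factor
`(sin θ)^{|m|} e^{imφ}` is `(u₀ + i u₁)^{|m|}` for `m ≥ 0` and `(u₀ - i u₁)^{|m|}` for `m < 0`. -/
def sphHarmonic (n : ℕ) (m : ℤ) (u : E3) : ℂ :=
  (sphNorm n m : ℂ)
    * (((Polynomial.derivative^[m.natAbs] (legendreP n)).eval (u 2) : ℝ) : ℂ)
    * ((u 0 : ℂ) + (if 0 ≤ m then Complex.I else -Complex.I) * (u 1 : ℂ)) ^ m.natAbs

/-- The function `y ↦ j_n(κ|y|) conj(Y_n^m(ŷ))`, where `ŷ = y/|y|`. -/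
def multipole (κ : ℝ) (n : ℕ) (m : ℤ) (y : E3) : ℂ :=
  (sphBessel n (κ * ‖y‖) : ℂ) * (starRingEnd ℂ) (sphHarmonic n m (‖y‖⁻¹ • y))

/-- The moments `α_n^m = ∫_{B_R} j_n(κ|y|) conj(Y_n^m(ŷ)) J(y) dy ∈ ℂ³`. -/
def alpha (κ R : ℝ) (J : E3 → C3) (n : ℕ) (m : ℤ) : Fin 3 → ℂ := fun l =>
  ∫ y in ballR R, multipole κ n m y * J y l

/-- The moments
`β_n^m = ∫_{B_R} ((I + κ⁻² ∇_y ∇_y) (j_n(κ|y|) conj(Y_n^m(ŷ)))) J(y) dy ∈ ℂ³`. -/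
def beta (κ R : ℝ) (J : E3 → C3) (n : ℕ) (m : ℤ) : Fin 3 → ℂ := fun l =>
  ∫ y in ballR R, ∑ s, dyad κ (multipole κ n m) y l s * J y s

/-- The field `J` on `B_R`, regarded as a source in `ℝ³` that vanishes outside `B_R`, is divergence
free: `∇ · J = 0` in the sense of distributions on `ℝ³`. If `J` has compact support in the open ball
`B_R`, this is the same as `∇ · J = 0` in the sense of distributions on `B_R`; see
`isDivergenceFree_iff_of_compact_support`. -/
def IsDivergenceFree (R : ℝ) (J : E3 → C3) : Prop :=
  ∀ η : E3 → ℂ, ContDiff ℝ ∞ η → HasCompactSupport η →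
    ∫ y in ballR R, ∑ s, pderiv s η y * J y s = 0

/-- For a source with compact support in the open ball, test functions supported in the ball
are enough. -/
theorem isDivergenceFree_iff_of_compact_support (R : ℝ) (J : E3 → C3) (D : Set E3)
    (hD : IsCompact D) (hDR : D ⊆ ballR R)
    (hJ : ∀ᵐ y ∂(volume.restrict (ballR R)), y ∉ D → J y = 0) :
    IsDivergenceFree R J ↔
      ∀ η : E3 → ℂ, ContDiff ℝ ∞ η → HasCompactSupport η → tsupport η ⊆ ballR R →
        ∫ y in ballR R, ∑ s, pderiv s η y * J y s = 0 := by
  refine ⟨fun h η h1 h2 _ => h η h1 h2, fun h η h1 h2 => ?_⟩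
  obtain ⟨f, hf0, hf1, -⟩ := exists_contMDiffMap_zero_one_nhds_of_isClosed
    (n := ⊤) (modelWithCornersSelf ℝ E3) (s := (ballR R)ᶜ) (t := D)
    (by rw [ballR]; exact Metric.isOpen_ball.isClosed_compl) hD.isClosed
    (Set.disjoint_left.2 fun x hx hx' => hx (hDR hx'))
  have hfs : ContDiff ℝ ∞ f := f.contMDiff.contDiff
  have key := h (fun y => (f y : ℂ) * η y)
    ((Complex.ofRealCLM.contDiff.comp hfs).mul h1) h2.mul_left (by
      intro x hx
      by_contra hxR
      have hz := (Filter.eventually_iff_exists_mem.1 (hf0.filter_mono (nhds_le_nhdsSet hxR)))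
      obtain ⟨v, hv, hv0⟩ := hz
      rw [tsupport, mem_closure_iff_nhds] at hx
      obtain ⟨z, hzv, hz⟩ := hx v hv
      exact hz (by simp [hv0 z hzv]))
  rw [← key]
  refine integral_congr_ae ?_
  filter_upwards [hJ] with y hy
  by_cases hyD : y ∈ D
  · refine Finset.sum_congr rfl fun s _ => ?_
    have : η =ᶠ[nhds y] fun y => (f y : ℂ) * η y := by
      filter_upwards [hf1.filter_mono (nhds_le_nhdsSet hyD)] with z hz
      simp [hz]
    rw [pderiv, pderiv, this.fderiv_eq]
  · simp [hy hyD]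

end Maxwell

end

/-!
The statement is reduced to a scalar one, and the scalar one is proved without the addition theorem
for spherical waves.

*Reduction.* The second derivatives `∂_l ∂_s F` of a function that is smooth near the closed ball
enter the integrals only through `∑_s ∂_s (∂_l F) J_s`, which integrates to zero since `∂_l F` agrees
with a test function on the ball (`integral_dyad_mul`). For `F` a multipole this gives `β = α`, and
for `F = g(x, ·)` it shows that the components of the field outside the ball are those of
`∫ g(x, y) J(y) dy` (`electricField_eq`). So let `f` be a component of `J`; it has to be shown that
`u(x) = ∫ e^{iκ|x-y|} / |x-y| f(y) dy` vanishes for `|x| > R` if and only if `f` is orthogonal to all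
multipoles. Both properties are compared with the vanishing of the field `v` of the regular kernel
`j_0(κ|x-y|) = sin(κ|x-y|) / (κ|x-y|)`.

*From `u` to `v`.* Along a ray `x = ρθ` the function `u` equals `e^{iκρ} ρ⁻¹ A(1/ρ)` with `A`
holomorphic in the disc `|z| < 1/R`. The incoming field `∫ e^{-iκ|x-y|} / |x-y| f(y) dy` equals
`e^{-iκρ} ρ⁻¹ B(1/ρ)`, where `B(z)` is the value at `-z` of the function `A` of the opposite ray. If
`u = 0` then all the functions `A` vanish, hence all the functions `B`, hence `v`. Conversely `v = 0`
says that `e^{iκ/z} A(z) = e^{-iκ/z} B(z)`. On the positive imaginary axis this forces `A` to decay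
exponentially in `1/|z|`, which an analytic function does only if it is zero
(`eqOn_zero_of_exp_mul_eq`). This gives `outgoingField_eq_zero_iff`.

*From `v` to the multipoles.* The field `v` is real analytic on lines, so it vanishes for `|x| > R`
if and only if it vanishes identically, if and only if all its derivatives at `0` vanish. Those are
the moments of `f` against the derivatives of `j_0(κ|y|)`. The span of these derivatives is the span
of the multipoles: `∂₀ ± i∂₁` takes the multipole of degree `n` and order `∓n` to a multiple of the
one of degree `n + 1` and order `∓(n + 1)` (`obliqueD_mode_self`), `∂₂` maps a multipole of degree
`n` to a combination of those of the same order and of degrees `n + 1` and `n - 1`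
(`partialD_two_mode_succ`), and `(∂₀ + i∂₁)(∂₀ - i∂₁)` is `-κ² - ∂₂²` by the Helmholtz equation
(`obliqueD_neg_obliqueD`). This gives `moments_eq_zero_iff`.
-/

namespace Maxwell

/-! ### The entire functions behind the spherical Bessel functions -/

/-- The entire function `Ψ_n(s) = ∑_k (-s/2)^k / (k! (2n+2k+1)!!)`, so that
`j_n(t) = tⁿ Ψ_n(t²)`. -/
noncomputable def besselEntire (n : ℕ) (s : ℂ) : ℂ :=
  ∑' k : ℕ, (-s / 2) ^ k / ((k ! : ℂ) * ((2 * n + 2 * k + 1)‼ : ℂ))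

theorem one_le_doubleFactorial (n : ℕ) : (1 : ℝ) ≤ (n‼ : ℝ) := by
  exact_mod_cast Nat.doubleFactorial_pos n

theorem norm_besselEntire_term_le (n k : ℕ) {r : ℝ} {s : ℂ} (hs : ‖s‖ ≤ r) :
    ‖(-s / 2) ^ k / ((k ! : ℂ) * ((2 * n + 2 * k + 1)‼ : ℂ))‖ ≤ (r / 2) ^ k / (k ! : ℝ) := by
  have h1 := one_le_doubleFactorial (2 * n + 2 * k + 1)
  have h2 : (0 : ℝ) < k ! := by positivity
  have hr : 0 ≤ r := (norm_nonneg s).trans hs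
  rw [norm_div, norm_pow, norm_div, norm_neg, norm_mul, Complex.norm_natCast, Complex.norm_natCast,
    Complex.norm_ofNat]
  gcongr
  exact le_mul_of_one_le_right h2.le h1

theorem summable_besselEntire (n : ℕ) (s : ℂ) :
    Summable fun k : ℕ => (-s / 2) ^ k / ((k ! : ℂ) * ((2 * n + 2 * k + 1)‼ : ℂ)) :=
  Summable.of_norm_bounded (Real.summable_pow_div_factorial (‖s‖ / 2))
    fun k => norm_besselEntire_term_le n k le_rfl

theorem hasDerivAt_besselEntire (n : ℕ) (s : ℂ) :
    HasDerivAt (besselEntire n) (-(1 / 2) * besselEntire (n + 1) s) s := by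
  set F : ℕ → ℂ → ℂ := fun k s => (-s / 2) ^ k / ((k ! : ℂ) * ((2 * n + 2 * k + 1)‼ : ℂ)) with hF
  have hdF : ∀ k, Differentiable ℂ (F k) := fun k => by simp only [hF]; fun_prop
  have hU : IsOpen (Metric.ball (0 : ℂ) (‖s‖ + 1)) := Metric.isOpen_ball
  have hs : s ∈ Metric.ball (0 : ℂ) (‖s‖ + 1) := by simp
  have hb : ∀ k, ∀ w ∈ Metric.ball (0 : ℂ) (‖s‖ + 1),
      ‖F k w‖ ≤ ((‖s‖ + 1) / 2) ^ k / (k ! : ℝ) := fun k w hw =>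
    norm_besselEntire_term_le n k (by simpa using (mem_ball_zero_iff.1 hw).le)
  have hsum := Real.summable_pow_div_factorial ((‖s‖ + 1) / 2)
  have h1 := Complex.hasSum_deriv_of_summable_norm hsum
    (fun k => (hdF k).differentiableOn) hU hb hs
  have h2 : DifferentiableAt ℂ (besselEntire n) s :=
    (Complex.differentiableOn_tsum_of_summable_norm hsum
      (fun k => (hdF k).differentiableOn) hU hb).differentiableAt (hU.mem_nhds hs)
  have hd : ∀ k, deriv (F (k + 1)) s
      = -(1 / 2) * ((-s / 2) ^ k / ((k ! : ℂ) * ((2 * (n + 1) + 2 * k + 1)‼ : ℂ))) := by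
    intro k
    have e : HasDerivAt (F (k + 1)) (((k + 1 : ℕ) : ℂ) * (-s / 2) ^ (k + 1 - 1) * (-1 / 2)
        / (((k + 1)! : ℂ) * ((2 * n + 2 * (k + 1) + 1)‼ : ℂ))) s :=
      ((((hasDerivAt_id s).neg.div_const 2).pow (k + 1))).div_const _
    rw [e.deriv, show 2 * n + 2 * (k + 1) + 1 = 2 * (n + 1) + 2 * k + 1 by ring,
      Nat.factorial_succ, Nat.add_sub_cancel]
    have h3 : ((k : ℂ) + 1) ≠ 0 := by exact_mod_cast k.succ_ne_zero
    have h4 : (k ! : ℂ) ≠ 0 := by exact_mod_cast k.factorial_ne_zero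
    have h5 : ((2 * (n + 1) + 2 * k + 1)‼ : ℂ) ≠ 0 := by
      exact_mod_cast (Nat.doubleFactorial_pos _).ne'
    push_cast
    field_simp
  have h0 : deriv (F 0) s = 0 := by
    have : F 0 = fun _ => 1 / (((0 : ℕ) ! : ℂ) * ((2 * n + 2 * 0 + 1)‼ : ℂ)) := by
      ext w; simp [hF]
    rw [this, deriv_const]
  have h6 : deriv (besselEntire n) s = -(1 / 2) * besselEntire (n + 1) s := by
    have : deriv (besselEntire n) s = ∑' k, deriv (F k) s := h1.tsum_eq.symm
    rw [this, h1.summable.tsum_eq_zero_add, h0, zero_add]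
    simp_rw [hd]
    rw [tsum_mul_left]
    rfl
  rw [← h6]
  exact h2.hasDerivAt

/-- The recurrence `j_n(t) + j_{n+2}(t) = (2n+3) j_{n+1}(t) / t` in terms of the `Ψ_n`. -/
theorem besselEntire_recurrence (n : ℕ) (s : ℂ) :
    besselEntire n s = (2 * n + 3) * besselEntire (n + 1) s - s * besselEntire (n + 2) s := by
  have s1 := (summable_besselEntire (n + 1) s).mul_left (2 * n + 3 : ℂ)
  have s2 := (summable_besselEntire (n + 2) s).mul_left s
  have s0 := summable_besselEntire n s
  have key : besselEntire n s - (2 * n + 3) * besselEntire (n + 1) s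
      = - (s * besselEntire (n + 2) s) := by
    unfold besselEntire
    rw [← tsum_mul_left, ← tsum_mul_left, ← (s0.tsum_sub s1), (s0.sub s1).tsum_eq_zero_add,
      ← tsum_neg]
    have e0 : (2 * (n : ℂ) + 3) * ((2 * n + 1)‼ : ℂ) = ((2 * (n + 1) + 1)‼ : ℂ) := by
      rw [show 2 * (n + 1) + 1 = (2 * n + 1) + 2 by ring, Nat.doubleFactorial_add_two]
      push_cast; ring
    have h5 : ∀ k, ((k)‼ : ℂ) ≠ 0 := fun k => by
      exact_mod_cast (Nat.doubleFactorial_pos _).ne'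
    have z : (-s / 2) ^ 0 / (((0 : ℕ) ! : ℂ) * ((2 * n + 2 * 0 + 1)‼ : ℂ)) - (2 * (n : ℂ) + 3) *
        ((-s / 2) ^ 0 / (((0 : ℕ) ! : ℂ) * ((2 * (n + 1) + 2 * 0 + 1)‼ : ℂ))) = 0 := by
      have h1 := h5 (2 * n + 1)
      have h2 : (2 * (n : ℂ) + 3) ≠ 0 := by exact_mod_cast (by omega : 2 * n + 3 ≠ 0)
      simp only [mul_zero, add_zero, ← e0]
      simp
      field_simp
      simp
    rw [z, zero_add]
    refine tsum_congr fun k => ?_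
    have h3 : ((k : ℂ) + 1) ≠ 0 := by exact_mod_cast k.succ_ne_zero
    have h4 : (k ! : ℂ) ≠ 0 := by exact_mod_cast k.factorial_ne_zero
    have e1 : ((2 * (n + 1) + 2 * (k + 1) + 1)‼ : ℂ)
        = (2 * n + 2 * k + 5) * ((2 * n + 2 * (k + 1) + 1)‼ : ℂ) := by
      rw [show 2 * (n + 1) + 2 * (k + 1) + 1 = (2 * n + 2 * (k + 1) + 1) + 2 by ring,
        Nat.doubleFactorial_add_two]
      push_cast; ring
    have e2 : 2 * (n + 2) + 2 * k + 1 = 2 * (n + 1) + 2 * (k + 1) + 1 := by ring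
    have h6 := h5 (2 * n + 2 * (k + 1) + 1)
    have h7 : (2 * (n : ℂ) + 2 * k + 5) ≠ 0 := by exact_mod_cast (by omega : 2 * n + 2 * k + 5 ≠ 0)
    rw [e2, e1, Nat.factorial_succ]
    push_cast
    generalize hc : 2 * (n : ℂ) + 2 * k + 5 = c at h7 ⊢
    field_simp
    linear_combination -(-s / 2) ^ (k + 1) * hc
  linear_combination key

theorem sphBessel_eq (n : ℕ) (t : ℝ) :
    (sphBessel n t : ℂ) = (t : ℂ) ^ n * besselEntire n ((t : ℂ) ^ 2) := by
  unfold sphBessel besselEntire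
  push_cast
  rfl

/-- `Ψ_0(t²) = sin t / t`, the spherical Bessel function of order zero. -/
theorem mul_besselEntire_zero (t : ℂ) : t * besselEntire 0 (t ^ 2) = Complex.sin t := by
  rw [← (Complex.hasSum_sin t).tsum_eq, besselEntire, ← tsum_mul_left]
  refine tsum_congr fun k => ?_
  have h4 : (k ! : ℂ) ≠ 0 := by exact_mod_cast k.factorial_ne_zero
  have h5 : ((2 * k + 1)‼ : ℂ) ≠ 0 := by
    exact_mod_cast (Nat.doubleFactorial_pos _).ne'
  have e : ((2 * k + 1)! : ℂ) = ((2 * k + 1)‼ : ℂ) * (2 ^ k * (k ! : ℂ)) := by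
    rw [Nat.factorial_eq_mul_doubleFactorial, Nat.doubleFactorial_two_mul]
    push_cast; ring
  rw [e]
  simp only [mul_zero, zero_add]
  rw [div_pow, neg_pow, ← pow_mul]
  field_simp
  ring

theorem contDiff_besselEntire_ofReal (n : ℕ) : ContDiff ℝ ∞ fun s : ℝ => besselEntire n s := by
  have hd : ∀ n : ℕ, ∀ s : ℝ, HasDerivAt (fun s : ℝ => besselEntire n s)
      (-(1 / 2) * besselEntire (n + 1) s) s := fun n s =>
    (hasDerivAt_besselEntire n s).comp_ofReal
  have hk : ∀ k : ℕ, ∀ n : ℕ, ContDiff ℝ k fun s : ℝ => besselEntire n s := by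
    intro k
    induction k with
    | zero =>
      intro n
      exact contDiff_zero.2 (continuous_iff_continuousAt.2 fun s => (hd n s).continuousAt)
    | succ k ih =>
      intro n
      rw [Nat.cast_succ]
      refine contDiff_succ_iff_deriv.2 ⟨fun s => (hd n s).differentiableAt, by simp, ?_⟩
      rw [show deriv (fun s : ℝ => besselEntire n s) = fun s : ℝ => -(1 / 2) * besselEntire (n + 1) s
        from funext fun s => (hd n s).deriv]
      exact contDiff_const.mul (ih (n + 1))
  exact contDiff_infty.2 fun k => hk k n

/-! ### Derivatives of Legendre polynomials -/

open Polynomial in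
/-- The polynomial `S = (2ᵐ m!)⁻¹ (d/dt)^{m+p-1} (t²-1)^m`, where `m = n + 1`, is the derivative of
order `p - 1` of `P_m`, also for `p = 0`. -/
theorem legendreP_recurrence_aux (n p : ℕ) :
    ∃ S : Polynomial ℝ,
      derivative^[p] (legendreP (n + 2)) = X * derivative^[p] (legendreP (n + 1))
        + C ((n + 1 + p : ℝ)) * S ∧
      derivative^[p] (legendreP (n + 2)) = derivative^[p] (legendreP n)
        + C (2 * n + 3 : ℝ) * S := by
  have hc : ∀ m : ℕ, ((2 : ℝ) ^ (m + 1) * ((m + 1)! : ℝ))⁻¹ * (2 * (m + 1))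
      = (2 ^ m * (m ! : ℝ))⁻¹ := by
    intro m
    rw [Nat.factorial_succ]
    have : (m ! : ℝ) ≠ 0 := by exact_mod_cast m.factorial_ne_zero
    have : (m : ℝ) + 1 ≠ 0 := by positivity
    push_cast
    rw [pow_succ]
    field_simp
  have hD : ∀ m : ℕ, derivative ((X ^ 2 - 1 : ℝ[X]) ^ (m + 1))
      = C (2 * (m + 1) : ℝ) * ((X ^ 2 - 1) ^ m * X) := by
    intro m
    rw [derivative_pow_succ]
    simp only [derivative_sub, derivative_X_pow, derivative_one, map_mul, map_add, map_one,
      map_natCast, map_ofNat]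
    simp
    ring
  have hD2 : derivative (derivative ((X ^ 2 - 1 : ℝ[X]) ^ (n + 2)))
      = C (2 * (n + 2) : ℝ) * (C (2 * n + 3 : ℝ) * (X ^ 2 - 1) ^ (n + 1)
        + C (2 * (n + 1) : ℝ) * (X ^ 2 - 1) ^ n) := by
    rw [hD (n + 1), derivative_C_mul, derivative_mul, derivative_X, hD n]
    simp only [map_mul, map_add, map_one, map_natCast, map_ofNat, Nat.cast_add, Nat.cast_one]
    ring
  refine ⟨C ((2 ^ (n + 1) * ((n + 1)! : ℝ))⁻¹) * derivative^[n + p] ((X ^ 2 - 1) ^ (n + 1)), ?_, ?_⟩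
  · simp only [legendreP, iterate_derivative_C_mul]
    rw [← Function.iterate_add_apply, ← Function.iterate_add_apply,
      show p + (n + 2) = (n + p + 1) + 1 by ring, Function.iterate_succ_apply, hD (n + 1),
      iterate_derivative_C_mul, iterate_derivative_mul_X, ← hc (n + 1),
      show p + (n + 1) = n + p + 1 by ring, Nat.add_sub_cancel, nsmul_eq_mul]
    simp only [map_mul, map_add, map_one, map_natCast, map_ofNat, Nat.cast_add, Nat.cast_one]
    ring
  · simp only [legendreP, iterate_derivative_C_mul]
    rw [← Function.iterate_add_apply, ← Function.iterate_add_apply,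
      show p + (n + 2) = (n + p) + 1 + 1 by ring, Function.iterate_succ_apply,
      Function.iterate_succ_apply, hD2, ← hc n, ← hc (n + 1)]
    simp only [iterate_derivative_C_mul, iterate_map_add, add_comm p n]
    generalize derivative^[n + p] ((X ^ 2 - 1 : ℝ[X]) ^ n) = A
    generalize derivative^[n + p] ((X ^ 2 - 1 : ℝ[X]) ^ (n + 1)) = B
    simp only [map_mul, map_add, map_one, map_natCast, map_ofNat, Nat.cast_add, Nat.cast_one]
    ring

open Polynomial in
theorem legendreP_recurrence (n p : ℕ) :
    C ((n : ℝ) + 2 - p) * derivative^[p] (legendreP (n + 2)) =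
      C (2 * n + 3 : ℝ) * X * derivative^[p] (legendreP (n + 1))
        - C ((n : ℝ) + 1 + p) * derivative^[p] (legendreP n) := by
  obtain ⟨S, h1, h2⟩ := legendreP_recurrence_aux n p
  simp only [map_mul, map_add, map_sub, map_one, map_natCast, map_ofNat] at *
  linear_combination (2 * (n : ℝ[X]) + 3) * h1 - ((n : ℝ[X]) + 1 + p) * h2

open Polynomial in
theorem natDegree_legendreP_le (n : ℕ) : (legendreP n).natDegree ≤ n := by
  refine (natDegree_C_mul_le _ _).trans ((natDegree_iterate_derivative _ _).trans ?_)
  have h : ((X ^ 2 - 1 : ℝ[X]) ^ n).natDegree ≤ n * 2 := by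
    refine natDegree_pow_le_of_le n ?_
    compute_degree
  omega

theorem legendreP_zero : legendreP 0 = 1 := by simp [legendreP]

theorem legendreP_one : legendreP 1 = Polynomial.X := by
  simp only [legendreP, pow_one, Nat.factorial_one, Nat.cast_one, mul_one,
    Function.iterate_one, Polynomial.derivative_sub, Polynomial.derivative_X_pow,
    Polynomial.derivative_one, sub_zero]
  rw [← mul_assoc, ← Polynomial.C_mul]
  simp

/-- The constant polynomial `(d/dt)^p P_p`, of value `(2p-1)!!`. -/
noncomputable def legendreLead : ℕ → ℝ
  | 0 => 1
  | p + 1 => (2 * p + 1) * legendreLead p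

theorem legendreLead_pos (p : ℕ) : 0 < legendreLead p := by
  induction p with
  | zero => simp [legendreLead]
  | succ p ih => rw [legendreLead]; positivity

open Polynomial in
theorem derivative_legendreP (p : ℕ) :
    derivative^[p] (legendreP p) = C (legendreLead p) ∧
      derivative^[p] (legendreP (p + 1)) = C (legendreLead (p + 1)) * X := by
  induction p with
  | zero => simp [legendreLead, legendreP_zero, legendreP_one]
  | succ p ih =>
    have h0 : derivative^[p + 1] (legendreP (p + 1)) = C (legendreLead (p + 1)) := by
      rw [Function.iterate_succ_apply', ih.2]
      simp
    refine ⟨h0, ?_⟩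
    have e : derivative^[p + 1] (legendreP p) = 0 :=
      iterate_derivative_eq_zero (Nat.lt_succ_of_le (natDegree_legendreP_le p))
    have h := legendreP_recurrence p (p + 1)
    have e1 : (p : ℝ) + 2 - (p + 1 : ℕ) = 1 := by push_cast; ring
    rw [e, h0, e1] at h
    simp only [map_one, one_mul, mul_zero, sub_zero] at h
    rw [h, legendreLead, mul_right_comm, ← C_mul]
    congr 3
    push_cast
    ring

/-- The polynomial `r^d (d/dt)^p P_{p+d} (c/r) / (2p-1)!!` in `c` and `ρ = r²`, defined by the
recurrence in `d` of the Legendre functions. -/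
noncomputable def zonalPoly (p : ℕ) : ℕ → ℝ → ℝ → ℝ
  | 0, _, _ => 1
  | 1, c, _ => (2 * p + 1) * c
  | d + 2, c, ρ => ((2 * (p + d) + 3) * c * zonalPoly p (d + 1) c ρ
      - (2 * p + d + 1) * ρ * zonalPoly p d c ρ) / (d + 2)

theorem zonalPoly_eq (p d : ℕ) (c r : ℝ) (hr : r ≠ 0) :
    r ^ d * (Polynomial.derivative^[p] (legendreP (p + d))).eval (r⁻¹ * c)
      = legendreLead p * zonalPoly p d c (r ^ 2) := by
  induction d using Nat.strong_induction_on with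
  | _ d ih =>
    match d with
    | 0 => simp [(derivative_legendreP p).1, zonalPoly]
    | 1 =>
      rw [(derivative_legendreP p).2]
      simp only [zonalPoly, legendreLead, Polynomial.eval_mul, Polynomial.eval_C,
        Polynomial.eval_X]
      field_simp
    | d + 2 =>
      have h0 := ih d (by omega)
      have h1 := ih (d + 1) (by omega)
      have h := congrArg (Polynomial.eval (r⁻¹ * c)) (legendreP_recurrence (p + d) p)
      simp only [Polynomial.eval_mul, Polynomial.eval_C, Polynomial.eval_sub,
        Polynomial.eval_X] at h
      rw [zonalPoly]
      have hd : (d : ℝ) + 2 ≠ 0 := by positivity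
      rw [← mul_div_assoc, eq_div_iff hd]
      push_cast at h
      rw [← add_assoc] at h1 ⊢
      generalize (Polynomial.derivative^[p] (legendreP (p + d + 2))).eval (r⁻¹ * c) = A2 at *
      generalize (Polynomial.derivative^[p] (legendreP (p + d + 1))).eval (r⁻¹ * c) = A1 at *
      generalize (Polynomial.derivative^[p] (legendreP (p + d))).eval (r⁻¹ * c) = A0 at *
      have e : r * (r⁻¹ * c) = c := by field_simp
      linear_combination r ^ (d + 2) * h + (2 * (p + d) + 3) * c * h1
        - (2 * p + d + 1) * r ^ 2 * h0 + (2 * (p + d) + 3) * r ^ (d + 1) * A1 * e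

/-- The derivative of `c ↦ Q(c, a + c²)` for the polynomials `Q` of `zonalPoly`: it lowers the
degree by one, as the derivative along the axis does with solid harmonics. -/
theorem hasDerivAt_zonalPoly (p d : ℕ) (a c : ℝ) :
    HasDerivAt (fun c => zonalPoly p (d + 1) c (a + c ^ 2))
      ((2 * p + d + 1) * zonalPoly p d c (a + c ^ 2)) c := by
  induction d using Nat.strong_induction_on with
  | _ d ih =>
    match d with
    | 0 =>
      simp only [zonalPoly]
      simpa using (hasDerivAt_id c).const_mul (2 * (p : ℝ) + 1)
    | 1 =>
      simp only [zonalPoly]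
      have h2 : HasDerivAt (fun c : ℝ => a + c ^ 2) (2 * c) c := by
        simpa using (hasDerivAt_pow 2 c).const_add a
      have h := ((((hasDerivAt_id c).const_mul (2 * ((p : ℝ) + (0 : ℕ)) + 3)).mul
        ((hasDerivAt_id c).const_mul (2 * (p : ℝ) + 1))).sub
        ((h2.const_mul (2 * (p : ℝ) + (0 : ℕ) + 1)).mul_const 1)).div_const (((0 : ℕ) : ℝ) + 2)
      refine h.congr_deriv ?_
      simp
      ring
    | d + 2 =>
      have h0 := ih d (by omega)
      have h1 := ih (d + 1) (by omega)
      have h2 : HasDerivAt (fun c : ℝ => a + c ^ 2) (2 * c) c := by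
        simpa using (hasDerivAt_pow 2 c).const_add a
      have h := ((((hasDerivAt_id c).const_mul (2 * ((p : ℝ) + (d + 1 : ℕ)) + 3)).mul h1).sub
        ((h2.const_mul (2 * (p : ℝ) + (d + 1 : ℕ) + 1)).mul h0)).div_const (((d + 1 : ℕ) : ℝ) + 2)
      have e : (fun c => zonalPoly p (d + 2 + 1) c (a + c ^ 2)) = fun c =>
        ((2 * ((p : ℝ) + (d + 1 : ℕ)) + 3) * c * zonalPoly p (d + 2) c (a + c ^ 2)
          - (2 * p + (d + 1 : ℕ) + 1) * (a + c ^ 2) * zonalPoly p (d + 1) c (a + c ^ 2))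
            / ((d + 1 : ℕ) + 2) := by
        ext c
        rw [zonalPoly]
      rw [e]
      refine h.congr_deriv ?_
      have hz : zonalPoly p (d + 2) c (a + c ^ 2) * (d + 2) =
          ((2 * (p + d) + 3) * c * zonalPoly p (d + 1) c (a + c ^ 2)
          - (2 * p + d + 1) * (a + c ^ 2) * zonalPoly p d c (a + c ^ 2)) := by
        rw [zonalPoly]
        field_simp
      have hd : ((d : ℝ) + 1 + 2) ≠ 0 := by positivity
      push_cast
      rw [div_eq_iff hd]
      simp only [id]
      linear_combination (-(2 * (p : ℝ) + d + 2)) * hz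

/-! ### Partial derivatives of smooth functions -/

theorem pderiv_eq_of_hasDerivAt {i : Fin 3} {w : E3 → ℂ} {y : E3} {L : ℂ}
    (hw : DifferentiableAt ℝ w y)
    (h : HasDerivAt (fun t : ℝ => w (y + t • EuclideanSpace.single i (1 : ℝ))) L 0) :
    pderiv i w y = L := by
  have h1 : HasDerivAt (fun t : ℝ => w (y + t • EuclideanSpace.single i (1 : ℝ)))
      (pderiv i w y) 0 := by
    exact hw.hasFDerivAt.hasLineDerivAt (EuclideanSpace.single i (1 : ℝ))
  exact h1.unique h

theorem contDiff_pderiv (i : Fin 3) {w : E3 → ℂ} (hw : ContDiff ℝ ∞ w) :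
    ContDiff ℝ ∞ (pderiv i w) :=
  (hw.fderiv_right (m := ∞) (by simp)).clm_apply contDiff_const

theorem pderiv_pderiv_eq {i j : Fin 3} {w : E3 → ℂ} {y : E3} (hw : ContDiffAt ℝ ∞ w y) :
    pderiv i (pderiv j w) y
      = fderiv ℝ (fderiv ℝ w) y (EuclideanSpace.single i 1) (EuclideanSpace.single j 1) := by
  have h : DifferentiableAt ℝ (fderiv ℝ w) y :=
    (hw.fderiv_right (m := ∞) (by simp)).differentiableAt (by simp)
  have := (h.hasFDerivAt.clm_apply
    (hasFDerivAt_const (EuclideanSpace.single j (1 : ℝ) : E3) y)).fderiv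
  rw [pderiv]
  unfold pderiv
  rw [this]
  simp

theorem pderiv_comm {i j : Fin 3} {w : E3 → ℂ} {y : E3} (hw : ContDiffAt ℝ ∞ w y) :
    pderiv i (pderiv j w) y = pderiv j (pderiv i w) y := by
  rw [pderiv_pderiv_eq hw, pderiv_pderiv_eq hw]
  have h2 : minSmoothness ℝ 2 ≤ ∞ := by
    rw [minSmoothness_of_isRCLikeNormedField]
    exact WithTop.coe_le_coe.2 le_top
  exact (hw.isSymmSndFDerivAt h2).eq _ _

/-- The space of smooth complex functions on `ℝ³`. -/
def SmoothFn : Submodule ℂ (E3 → ℂ) where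
  carrier := {w | ContDiff ℝ ∞ w}
  add_mem' {u v} (h1 : ContDiff ℝ ∞ u) (h2 : ContDiff ℝ ∞ v) := h1.add h2
  zero_mem' := (contDiff_const : ContDiff ℝ ∞ fun _ : E3 => (0 : ℂ))
  smul_mem' c u (h : ContDiff ℝ ∞ u) := h.const_smul c

theorem mem_smoothFn {w : E3 → ℂ} : w ∈ SmoothFn ↔ ContDiff ℝ ∞ w := Iff.rfl

theorem contDiff_smoothFn (w : SmoothFn) : ContDiff ℝ ∞ (w : E3 → ℂ) := mem_smoothFn.1 w.2

@[simp]
theorem smoothFn_add_apply (u v : SmoothFn) (y : E3) :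
    ((u + v : SmoothFn) : E3 → ℂ) y = (u : E3 → ℂ) y + (v : E3 → ℂ) y := rfl

@[simp]
theorem smoothFn_smul_apply (c : ℂ) (u : SmoothFn) (y : E3) :
    ((c • u : SmoothFn) : E3 → ℂ) y = c * (u : E3 → ℂ) y := rfl

theorem differentiable_smoothFn (w : SmoothFn) : Differentiable ℝ w.1 :=
  (contDiff_smoothFn w).differentiable (by simp)

/-- The partial derivative `∂/∂y_i` as an endomorphism of the space of smooth functions. -/
noncomputable def partialD (i : Fin 3) : Module.End ℂ SmoothFn where
  toFun w := ⟨pderiv i w, mem_smoothFn.2 (contDiff_pderiv i (contDiff_smoothFn w))⟩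
  map_add' u v := by
    ext y
    change fderiv ℝ (u.1 + v.1) y _ = fderiv ℝ u.1 y _ + fderiv ℝ v.1 y _
    rw [fderiv_add (differentiable_smoothFn u y) (differentiable_smoothFn v y)]
    rfl
  map_smul' c u := by
    ext y
    change fderiv ℝ (c • u.1) y _ = c * fderiv ℝ u.1 y _
    rw [fderiv_const_smul (differentiable_smoothFn u y)]
    rfl

@[simp]
theorem partialD_apply (i : Fin 3) (w : SmoothFn) : (partialD i w : E3 → ℂ) = pderiv i w := rfl

theorem partialD_commute (i j : Fin 3) : Commute (partialD i) (partialD j) := by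
  ext w y
  exact pderiv_comm (contDiff_smoothFn w).contDiffAt

/-- The complex directional derivative `∂₀ + σ ∂₁`. -/
noncomputable def obliqueD (σ : ℂ) : Module.End ℂ SmoothFn := partialD 0 + σ • partialD 1

/-! ### The multipoles as smooth functions -/

theorem contDiff_coord (i : Fin 3) : ContDiff ℝ ∞ fun y : E3 => y i := by fun_prop

theorem contDiff_ofReal_comp {f : E3 → ℝ} (hf : ContDiff ℝ ∞ f) :
    ContDiff ℝ ∞ fun y : E3 => (f y : ℂ) :=
  Complex.ofRealCLM.contDiff.comp hf

theorem contDiff_zonalPoly (p d : ℕ) :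
    ContDiff ℝ ∞ fun y : E3 => zonalPoly p d (y 2) (‖y‖ ^ 2) := by
  induction d using Nat.strong_induction_on with
  | _ d ih =>
    match d with
    | 0 => simpa only [zonalPoly] using contDiff_const
    | 1 => simpa only [zonalPoly] using contDiff_const.mul (contDiff_coord 2)
    | d + 2 =>
      have h0 := ih d (by omega)
      have h1 := ih (d + 1) (by omega)
      have h2 : ContDiff ℝ ∞ fun y : E3 => ‖y‖ ^ 2 := contDiff_norm_sq ℝ
      simp only [zonalPoly]
      exact (((contDiff_const.mul (contDiff_coord 2)).mul h1).sub
        ((contDiff_const.mul h2).mul h0)).div_const _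

/-- The function `Ψ_{p+d}(κ²|y|²) (y₀ + σ y₁)^p Q(y₂, |y|²)`, with `Q` of degree `d` as in
`zonalPoly`. For `σ = ∓ i` it is a nonzero multiple of the multipole of degree `n = p + d` and order
`m = ± p`, see `multipole_eq`. -/
noncomputable def modeFn (κ : ℝ) (σ : ℂ) (p d : ℕ) (y : E3) : ℂ :=
  besselEntire (p + d) ((κ ^ 2 * ‖y‖ ^ 2 : ℝ) : ℂ) * ((y 0 : ℂ) + σ * (y 1 : ℂ)) ^ p
    * (zonalPoly p d (y 2) (‖y‖ ^ 2) : ℂ)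

theorem contDiff_modeFn (κ : ℝ) (σ : ℂ) (p d : ℕ) : ContDiff ℝ ∞ (modeFn κ σ p d) := by
  have h2 : ContDiff ℝ ∞ fun y : E3 => κ ^ 2 * ‖y‖ ^ 2 := contDiff_const.mul (contDiff_norm_sq ℝ)
  exact (((contDiff_besselEntire_ofReal (p + d)).comp h2).mul
    (((contDiff_ofReal_comp (contDiff_coord 0)).add
      (contDiff_const.mul (contDiff_ofReal_comp (contDiff_coord 1)))).pow p)).mul
    (contDiff_ofReal_comp (contDiff_zonalPoly p d))

/-- `modeFn` as an element of `SmoothFn`. -/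
noncomputable def mode (κ : ℝ) (σ : ℂ) (p d : ℕ) : SmoothFn :=
  ⟨modeFn κ σ p d, mem_smoothFn.2 (contDiff_modeFn κ σ p d)⟩

@[simp]
theorem coe_mode (κ : ℝ) (σ : ℂ) (p d : ℕ) : (mode κ σ p d : E3 → ℂ) = modeFn κ σ p d := rfl

theorem mode_zero_zero (κ : ℝ) (σ τ : ℂ) : mode κ σ 0 0 = mode κ τ 0 0 := by
  ext y
  simp [modeFn]

theorem norm_sq_eq_sum (y : E3) : ‖y‖ ^ 2 = y 0 ^ 2 + y 1 ^ 2 + y 2 ^ 2 := by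
  rw [EuclideanSpace.real_norm_sq_eq, Fin.sum_univ_three]

theorem zonalPoly_zero_zero (p d : ℕ) : zonalPoly p (d + 1) 0 0 = 0 := by
  cases d <;> simp [zonalPoly]

/-- The value of `σ` for which the multipole of order `m` is a multiple of `modeFn κ σ`. -/
noncomputable def orderSign (m : ℤ) : ℂ := if 0 ≤ m then -Complex.I else Complex.I

theorem multipole_eq (κ : ℝ) (n : ℕ) (m : ℤ) (hm : m.natAbs ≤ n) (y : E3) :
    multipole κ n m y = ((κ ^ n * sphNorm n m * legendreLead m.natAbs : ℝ) : ℂ)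
      * modeFn κ (orderSign m) m.natAbs (n - m.natAbs) y := by
  have hsg : (starRingEnd ℂ) (if 0 ≤ m then Complex.I else -Complex.I) = orderSign m := by
    unfold orderSign; split_ifs <;> simp
  unfold multipole sphHarmonic
  rw [map_mul, map_mul, map_pow, map_add, map_mul, hsg, Complex.conj_ofReal, Complex.conj_ofReal,
    Complex.conj_ofReal, Complex.conj_ofReal, sphBessel_eq]
  unfold modeFn
  generalize orderSign m = σ
  generalize m.natAbs = p at *
  obtain ⟨d, rfl⟩ := Nat.exists_eq_add_of_le hm
  rw [Nat.add_sub_cancel_left]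
  by_cases hy : y = 0
  · subst hy
    simp only [norm_zero, PiLp.zero_apply, smul_zero, Complex.ofReal_zero, mul_zero, add_zero,
      ne_eq, OfNat.ofNat_ne_zero, not_false_eq_true, zero_pow]
    rcases p with _ | p
    · rcases d with _ | d
      · simp [zonalPoly, legendreLead, legendreP_zero]; ring
      · simp [zonalPoly_zero_zero]
    · simp
  · have hr : ‖y‖ ≠ 0 := norm_ne_zero_iff.2 hy
    have hrc : (‖y‖ : ℂ) ≠ 0 := by exact_mod_cast hr
    have h := congrArg (fun x : ℝ => (x : ℂ)) (zonalPoly_eq p d (y 2) ‖y‖ hr)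
    simp only [PiLp.smul_apply, smul_eq_mul]
    push_cast at h ⊢
    rw [show (‖y‖ : ℂ)⁻¹ * (y 0 : ℂ) + σ * ((‖y‖ : ℂ)⁻¹ * (y 1 : ℂ))
      = (‖y‖ : ℂ)⁻¹ * ((y 0 : ℂ) + σ * (y 1 : ℂ)) by ring, mul_pow, mul_pow, mul_pow]
    have e : (‖y‖ : ℂ) ^ (p + d) * ((‖y‖ : ℂ)⁻¹) ^ p = (‖y‖ : ℂ) ^ d := by
      rw [pow_add, inv_pow]; field_simp
    generalize besselEntire (p + d) _ = B
    linear_combination (κ : ℂ) ^ (p + d) * B * (sphNorm (p + d) m : ℂ)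
      * ((y 0 : ℂ) + σ * (y 1 : ℂ)) ^ p * h
      + (κ : ℂ) ^ (p + d) * B * (sphNorm (p + d) m : ℂ) * ((y 0 : ℂ) + σ * (y 1 : ℂ)) ^ p
        * ((Polynomial.eval (‖y‖⁻¹ * y 2)
          (Polynomial.derivative^[p] (legendreP (p + d))) : ℝ) : ℂ) * e

/-! ### Ladder relations between the multipoles -/

theorem hasDerivAt_besselEntire_sq (κ : ℝ) (n : ℕ) (a c : ℝ) :
    HasDerivAt (fun c : ℝ => besselEntire n ((κ ^ 2 * (a + c ^ 2) : ℝ) : ℂ))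
      (-(κ ^ 2 * c) * besselEntire (n + 1) ((κ ^ 2 * (a + c ^ 2) : ℝ) : ℂ)) c := by
  have h1 : HasDerivAt (fun c : ℝ => ((κ ^ 2 * (a + c ^ 2) : ℝ) : ℂ))
      ((κ ^ 2 * (2 * c) : ℝ) : ℂ) c := by
    have : HasDerivAt (fun c : ℝ => κ ^ 2 * (a + c ^ 2)) (κ ^ 2 * (2 * c)) c := by
      simpa using ((hasDerivAt_pow 2 c).const_add a).const_mul (κ ^ 2)
    exact this.ofReal_comp
  have h := (hasDerivAt_besselEntire n ((κ ^ 2 * (a + c ^ 2) : ℝ) : ℂ)).comp c h1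
  refine h.congr_deriv ?_
  push_cast
  ring

theorem pderiv_two_modeFn {κ : ℝ} {σ : ℂ} {p d : ℕ} {y : E3} {Q' : ℝ}
    (hQ : HasDerivAt (fun c => zonalPoly p d c (y 0 ^ 2 + y 1 ^ 2 + c ^ 2)) Q' (y 2)) :
    pderiv 2 (modeFn κ σ p d) y = ((y 0 : ℂ) + σ * (y 1 : ℂ)) ^ p *
      (-(κ ^ 2 * y 2) * besselEntire (p + d + 1) ((κ ^ 2 * ‖y‖ ^ 2 : ℝ) : ℂ)
          * (zonalPoly p d (y 2) (‖y‖ ^ 2) : ℂ)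
        + besselEntire (p + d) ((κ ^ 2 * ‖y‖ ^ 2 : ℝ) : ℂ) * (Q' : ℂ)) := by
  refine pderiv_eq_of_hasDerivAt
    ((contDiff_modeFn κ σ p d).differentiable (by simp) y) ?_
  have h1 := ((hasDerivAt_besselEntire_sq κ (p + d) (y 0 ^ 2 + y 1 ^ 2) (y 2)).mul_const
    (((y 0 : ℂ) + σ * (y 1 : ℂ)) ^ p)).mul hQ.ofReal_comp
  have h2 : HasDerivAt (fun t : ℝ => y 2 + t) 1 0 := (hasDerivAt_id (0 : ℝ)).const_add (y 2)
  rw [← add_zero (y 2)] at h1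
  have h3 := HasDerivAt.scomp (0 : ℝ) h1 h2
  have e : (fun t : ℝ => modeFn κ σ p d (y + t • EuclideanSpace.single 2 (1 : ℝ))) =
    ((fun c : ℝ => besselEntire (p + d) ((κ ^ 2 * (y 0 ^ 2 + y 1 ^ 2 + c ^ 2) : ℝ) : ℂ)
        * ((y 0 : ℂ) + σ * (y 1 : ℂ)) ^ p) *
      fun c : ℝ => (zonalPoly p d c (y 0 ^ 2 + y 1 ^ 2 + c ^ 2) : ℂ)) ∘ fun t : ℝ => y 2 + t := by
    ext t
    simp [modeFn, norm_sq_eq_sum]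
  rw [e]
  refine h3.congr_deriv ?_
  simp only [one_smul, add_zero, norm_sq_eq_sum y]
  ring

theorem partialD_two_mode_zero (κ : ℝ) (σ : ℂ) (p : ℕ) :
    partialD 2 (mode κ σ p 0) = (-(κ : ℂ) ^ 2 / (2 * p + 1)) • mode κ σ p 1 := by
  ext y
  have hp : (2 * (p : ℂ) + 1) ≠ 0 := by exact_mod_cast (by omega : 2 * p + 1 ≠ 0)
  have hQ : HasDerivAt (fun c => zonalPoly p 0 c (y 0 ^ 2 + y 1 ^ 2 + c ^ 2)) 0 (y 2) := by
    simpa only [zonalPoly] using hasDerivAt_const (y 2) (1 : ℝ)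
  have := pderiv_two_modeFn (κ := κ) (σ := σ) hQ
  simp only [partialD_apply, coe_mode, this, smoothFn_smul_apply, modeFn, zonalPoly]
  push_cast
  field_simp
  ring_nf

theorem partialD_two_mode_succ (κ : ℝ) (σ : ℂ) (p d : ℕ) :
    partialD 2 (mode κ σ p (d + 1)) =
      (-(κ : ℂ) ^ 2 * (d + 2) / (2 * (p + d) + 3)) • mode κ σ p (d + 2)
        + (((2 * p + d + 1) : ℂ) / (2 * (p + d) + 3)) • mode κ σ p d := by
  ext y
  have hp : (2 * ((p : ℂ) + d) + 3) ≠ 0 := by exact_mod_cast (by omega : 2 * (p + d) + 3 ≠ 0)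
  have := pderiv_two_modeFn (κ := κ) (σ := σ) (hasDerivAt_zonalPoly p d (y 0 ^ 2 + y 1 ^ 2) (y 2))
  rw [← norm_sq_eq_sum] at this
  have hz : (zonalPoly p (d + 2) (y 2) (‖y‖ ^ 2) : ℂ) * (d + 2) =
      ((2 * (p + d) + 3) * y 2 * zonalPoly p (d + 1) (y 2) (‖y‖ ^ 2)
      - (2 * p + d + 1) * ‖y‖ ^ 2 * zonalPoly p d (y 2) (‖y‖ ^ 2)) := by
    have : zonalPoly p (d + 2) (y 2) (‖y‖ ^ 2) * (d + 2) =
      ((2 * (p + d) + 3) * y 2 * zonalPoly p (d + 1) (y 2) (‖y‖ ^ 2)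
      - (2 * p + d + 1) * ‖y‖ ^ 2 * zonalPoly p d (y 2) (‖y‖ ^ 2)) := by
      rw [zonalPoly]
      field_simp
    exact_mod_cast this
  have hb := besselEntire_recurrence (p + d) ((κ ^ 2 * ‖y‖ ^ 2 : ℝ) : ℂ)
  simp only [partialD_apply, coe_mode, this, smoothFn_smul_apply, smoothFn_add_apply, modeFn]
  rw [show p + (d + 2) = p + d + 2 by ring, show p + (d + 1) + 1 = p + d + 2 by ring,
    show p + (d + 1) = p + d + 1 by ring]
  clear this
  push_cast at hb ⊢
  generalize besselEntire (p + d + 2) _ = B2 at *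
  generalize besselEntire (p + d + 1) _ = B1 at *
  generalize besselEntire (p + d) _ = B0 at *
  generalize (zonalPoly p (d + 2) (y 2) (‖y‖ ^ 2) : ℂ) = Q2 at *
  generalize (zonalPoly p (d + 1) (y 2) (‖y‖ ^ 2) : ℂ) = Q1 at *
  generalize (zonalPoly p d (y 2) (‖y‖ ^ 2) : ℂ) = Q0 at *
  generalize ((y 0 : ℂ) + σ * (y 1 : ℂ)) ^ p = A
  generalize hc : 2 * ((p : ℂ) + d) + 3 = c at *
  rw [div_mul_eq_mul_div, div_mul_eq_mul_div, ← add_div, eq_div_iff hp, hb]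
  linear_combination A * κ ^ 2 * B2 * hz

theorem pderiv_zero_modeFn (κ : ℝ) (σ : ℂ) (p : ℕ) (y : E3) :
    pderiv 0 (modeFn κ σ p 0) y =
      -(κ ^ 2 * y 0) * besselEntire (p + 1) ((κ ^ 2 * ‖y‖ ^ 2 : ℝ) : ℂ)
          * ((y 0 : ℂ) + σ * (y 1 : ℂ)) ^ p
        + besselEntire p ((κ ^ 2 * ‖y‖ ^ 2 : ℝ) : ℂ)
          * (p * ((y 0 : ℂ) + σ * (y 1 : ℂ)) ^ (p - 1)) := by
  refine pderiv_eq_of_hasDerivAt ((contDiff_modeFn κ σ p 0).differentiable (by simp) y) ?_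
  have h0 : HasDerivAt (fun c : ℝ => ((c : ℂ) + σ * (y 1 : ℂ)) ^ p)
      (p * ((y 0 : ℂ) + σ * (y 1 : ℂ)) ^ (p - 1)) (y 0) := by
    simpa using (((hasDerivAt_id (y 0)).ofReal_comp).add_const (σ * (y 1 : ℂ))).fun_pow p
  have h1 := (hasDerivAt_besselEntire_sq κ p (y 1 ^ 2 + y 2 ^ 2) (y 0)).mul h0
  have h2 : HasDerivAt (fun t : ℝ => y 0 + t) 1 0 := (hasDerivAt_id (0 : ℝ)).const_add (y 0)
  rw [← add_zero (y 0)] at h1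
  have h3 := HasDerivAt.scomp (0 : ℝ) h1 h2
  have e : (fun t : ℝ => modeFn κ σ p 0 (y + t • EuclideanSpace.single 0 (1 : ℝ))) =
      ((fun c : ℝ => besselEntire p ((κ ^ 2 * (y 1 ^ 2 + y 2 ^ 2 + c ^ 2) : ℝ) : ℂ)) *
        fun c : ℝ => ((c : ℂ) + σ * (y 1 : ℂ)) ^ p) ∘ fun t : ℝ => y 0 + t := by
    ext t
    simp [modeFn, norm_sq_eq_sum, zonalPoly]
    ring_nf
    tauto
  rw [e]
  refine h3.congr_deriv ?_
  simp only [one_smul, add_zero, norm_sq_eq_sum y]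
  ring_nf

theorem pderiv_one_modeFn (κ : ℝ) (σ : ℂ) (p : ℕ) (y : E3) :
    pderiv 1 (modeFn κ σ p 0) y =
      -(κ ^ 2 * y 1) * besselEntire (p + 1) ((κ ^ 2 * ‖y‖ ^ 2 : ℝ) : ℂ)
          * ((y 0 : ℂ) + σ * (y 1 : ℂ)) ^ p
        + besselEntire p ((κ ^ 2 * ‖y‖ ^ 2 : ℝ) : ℂ)
          * (p * ((y 0 : ℂ) + σ * (y 1 : ℂ)) ^ (p - 1) * σ) := by
  refine pderiv_eq_of_hasDerivAt ((contDiff_modeFn κ σ p 0).differentiable (by simp) y) ?_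
  have h0 : HasDerivAt (fun c : ℝ => ((y 0 : ℂ) + σ * (c : ℂ)) ^ p)
      (p * ((y 0 : ℂ) + σ * (y 1 : ℂ)) ^ (p - 1) * σ) (y 1) := by
    simpa using ((((hasDerivAt_id (y 1)).ofReal_comp).const_mul σ).const_add (y 0 : ℂ)).fun_pow p
  have h1 := (hasDerivAt_besselEntire_sq κ p (y 0 ^ 2 + y 2 ^ 2) (y 1)).mul h0
  have h2 : HasDerivAt (fun t : ℝ => y 1 + t) 1 0 := (hasDerivAt_id (0 : ℝ)).const_add (y 1)
  rw [← add_zero (y 1)] at h1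
  have h3 := HasDerivAt.scomp (0 : ℝ) h1 h2
  have e : (fun t : ℝ => modeFn κ σ p 0 (y + t • EuclideanSpace.single 1 (1 : ℝ))) =
      ((fun c : ℝ => besselEntire p ((κ ^ 2 * (y 0 ^ 2 + y 2 ^ 2 + c ^ 2) : ℝ) : ℂ)) *
        fun c : ℝ => ((y 0 : ℂ) + σ * (c : ℂ)) ^ p) ∘ fun t : ℝ => y 1 + t := by
    ext t
    simp [modeFn, norm_sq_eq_sum, zonalPoly]
    ring_nf
    tauto
  rw [e]
  refine h3.congr_deriv ?_
  simp only [one_smul, add_zero, norm_sq_eq_sum y]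
  ring_nf

theorem obliqueD_mode_apply (κ : ℝ) (σ τ : ℂ) (p : ℕ) (y : E3) :
    (obliqueD τ (mode κ σ p 0) : E3 → ℂ) y =
      -κ ^ 2 * besselEntire (p + 1) ((κ ^ 2 * ‖y‖ ^ 2 : ℝ) : ℂ)
          * (((y 0 : ℂ) + τ * y 1) * ((y 0 : ℂ) + σ * (y 1 : ℂ)) ^ p)
        + besselEntire p ((κ ^ 2 * ‖y‖ ^ 2 : ℝ) : ℂ)
          * (p * ((y 0 : ℂ) + σ * (y 1 : ℂ)) ^ (p - 1) * (1 + σ * τ)) := by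
  simp only [obliqueD, LinearMap.add_apply, LinearMap.smul_apply, smoothFn_add_apply,
    smoothFn_smul_apply, partialD_apply, coe_mode, pderiv_zero_modeFn, pderiv_one_modeFn]
  ring

theorem obliqueD_mode_self (κ : ℝ) {σ : ℂ} (hσ : σ * σ = -1) (p : ℕ) :
    obliqueD σ (mode κ σ p 0) = (-(κ : ℂ) ^ 2) • mode κ σ (p + 1) 0 := by
  ext y
  rw [obliqueD_mode_apply, hσ]
  simp only [smoothFn_smul_apply, coe_mode, modeFn, zonalPoly]
  push_cast
  ring_nf

theorem obliqueD_pow_mode (κ : ℝ) {σ : ℂ} (hσ : σ * σ = -1) (p : ℕ) :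
    (obliqueD σ ^ p) (mode κ σ 0 0) = (-(κ : ℂ) ^ 2) ^ p • mode κ σ p 0 := by
  induction p with
  | zero => simp
  | succ p ih => rw [pow_succ', Module.End.mul_apply, ih, map_smul, obliqueD_mode_self κ hσ,
      smul_smul, pow_succ (-(κ : ℂ) ^ 2)]

/-- The Helmholtz equation for `j_0(κ|y|)`, with `∂₀² + ∂₁²` factored as
`(∂₀ - σ∂₁)(∂₀ + σ∂₁)`. -/
theorem obliqueD_neg_obliqueD (κ : ℝ) {σ : ℂ} (hσ : σ * σ = -1) :
    obliqueD (-σ) (obliqueD σ (mode κ σ 0 0)) =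
      (-(κ : ℂ) ^ 2) • mode κ σ 0 0 - partialD 2 (partialD 2 (mode κ σ 0 0)) := by
  rw [obliqueD_mode_self κ hσ, partialD_two_mode_zero, map_smul, map_smul,
    partialD_two_mode_succ, eq_sub_iff_add_eq]
  ext y
  have hb := besselEntire_recurrence 0 ((κ ^ 2 * ‖y‖ ^ 2 : ℝ) : ℂ)
  have hn : (‖y‖ : ℂ) ^ 2 = (y 0 : ℂ) ^ 2 + (y 1 : ℂ) ^ 2 + (y 2 : ℂ) ^ 2 := by
    exact_mod_cast norm_sq_eq_sum y
  simp only [smoothFn_add_apply, smoothFn_smul_apply, coe_mode, obliqueD_mode_apply]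
  simp only [modeFn, zonalPoly]
  push_cast at hb ⊢
  simp only [zero_add, mul_zero, add_zero, one_mul, mul_one, pow_zero, pow_one] at hb ⊢
  generalize besselEntire 2 _ = B2 at *
  generalize besselEntire 1 _ = B1 at *
  generalize besselEntire 0 _ = B0 at *
  linear_combination (κ : ℂ) ^ 4 * B2 * (-hn - (y 1 : ℂ) ^ 2 * hσ) + (κ : ℂ) ^ 2 * B1 * hσ
    + (κ : ℂ) ^ 2 * hb * (2 / 3)

theorem partialD_commute_obliqueD (i : Fin 3) (σ : ℂ) : Commute (partialD i) (obliqueD σ) :=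
  (partialD_commute i 0).add_right ((partialD_commute i 1).smul_right σ)

theorem obliqueD_commute (σ τ : ℂ) : Commute (obliqueD σ) (obliqueD τ) :=
  (partialD_commute_obliqueD 0 τ).add_left ((partialD_commute_obliqueD 1 τ).smul_left σ)

/-- Every multipole is obtained from `j_0(κ|y|)` by differentiation. -/
theorem mode_mem_of_partialD_mem {κ : ℝ} (hκ : κ ≠ 0) {N : Submodule ℂ SmoothFn}
    (hN : ∀ i, ∀ w ∈ N, partialD i w ∈ N) (h0 : mode κ Complex.I 0 0 ∈ N) {σ : ℂ}
    (hσ : σ * σ = -1) (p d : ℕ) : mode κ σ p d ∈ N := by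
  have hκ2 : (κ : ℂ) ^ 2 ≠ 0 := by exact_mod_cast pow_ne_zero 2 hκ
  have hob : ∀ w ∈ N, obliqueD σ w ∈ N := fun w hw =>
    N.add_mem (hN 0 w hw) (N.smul_mem σ (hN 1 w hw))
  have hp : ∀ p, mode κ σ p 0 ∈ N := by
    intro p
    induction p with
    | zero => rwa [mode_zero_zero κ σ Complex.I]
    | succ p ih =>
      have := hob _ ih
      rw [obliqueD_mode_self κ hσ] at this
      exact (N.smul_mem_iff (neg_ne_zero.2 hκ2)).1 this
  induction d using Nat.strong_induction_on with
  | _ d ih =>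
    match d with
    | 0 => exact hp p
    | 1 =>
      have := hN 2 _ (hp p)
      rw [partialD_two_mode_zero] at this
      refine (N.smul_mem_iff (div_ne_zero (neg_ne_zero.2 hκ2) ?_)).1 this
      exact_mod_cast (by omega : 2 * p + 1 ≠ 0)
    | d + 2 =>
      have := hN 2 _ (ih (d + 1) (by omega))
      rw [partialD_two_mode_succ] at this
      have h2 := (N.add_mem_iff_left (N.smul_mem _ (ih d (by omega)))).1 this
      refine (N.smul_mem_iff (div_ne_zero (mul_ne_zero (neg_ne_zero.2 hκ2) ?_) ?_)).1 h2
      · exact_mod_cast (by omega : d + 2 ≠ 0)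
      · exact_mod_cast (by omega : 2 * (p + d) + 3 ≠ 0)

/-- The span of the functions `∂₂^l (∂₀ + σ∂₁)^p j_0(κ|y|)` with `σ = ± i`. -/
noncomputable def derivSpan (κ : ℝ) : Submodule ℂ SmoothFn :=
  Submodule.span ℂ {w | ∃ (σ : ℂ) (p l : ℕ), σ * σ = -1 ∧
    w = (partialD 2 ^ l) ((obliqueD σ ^ p) (mode κ Complex.I 0 0))}

theorem mem_derivSpan (κ : ℝ) {σ : ℂ} (hσ : σ * σ = -1) (p l : ℕ) :
    (partialD 2 ^ l) ((obliqueD σ ^ p) (mode κ Complex.I 0 0)) ∈ derivSpan κ :=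
  Submodule.subset_span ⟨σ, p, l, hσ, rfl⟩

theorem partialD_two_mem_derivSpan (κ : ℝ) {w : SmoothFn} (hw : w ∈ derivSpan κ) :
    partialD 2 w ∈ derivSpan κ := by
  induction hw using Submodule.span_induction with
  | mem w hw =>
    obtain ⟨σ, p, l, hσ, rfl⟩ := hw
    rw [← Module.End.mul_apply, ← pow_succ']
    exact mem_derivSpan κ hσ p (l + 1)
  | zero => simp
  | add u v _ _ hu hv => rw [map_add]; exact Submodule.add_mem _ hu hv
  | smul c u _ hu => rw [map_smul]; exact Submodule.smul_mem _ c hu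

theorem obliqueD_mem_derivSpan (κ : ℝ) {τ : ℂ} (hτ : τ * τ = -1) {w : SmoothFn}
    (hw : w ∈ derivSpan κ) : obliqueD τ w ∈ derivSpan κ := by
  induction hw using Submodule.span_induction with
  | mem w hw =>
    obtain ⟨σ, p, l, hσ, rfl⟩ := hw
    have hcomm : ∀ v, obliqueD τ ((partialD 2 ^ l) v) = (partialD 2 ^ l) (obliqueD τ v) :=
      fun v => (LinearMap.congr_fun ((partialD_commute_obliqueD 2 τ).pow_left l).eq v).symm
    rw [hcomm]
    rcases mul_self_eq_mul_self_iff.1 (hτ.trans hσ.symm) with rfl | rfl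
    · rw [← Module.End.mul_apply (obliqueD τ), ← pow_succ']
      exact mem_derivSpan κ hτ (p + 1) l
    · rcases p with _ | p
      · simpa using mem_derivSpan κ hτ 1 l
      · have h1 : obliqueD (-σ) ((obliqueD σ ^ (p + 1)) (mode κ Complex.I 0 0)) =
            (obliqueD σ ^ p) ((-(κ : ℂ) ^ 2) • mode κ Complex.I 0 0)
              - partialD 2 (partialD 2 ((obliqueD σ ^ p) (mode κ Complex.I 0 0))) := by
          have h2 := obliqueD_neg_obliqueD κ hσ
          rw [mode_zero_zero κ σ Complex.I] at h2
          have c1 := ((obliqueD_commute (-σ) σ).pow_right p).eq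
          have c2 := ((partialD_commute_obliqueD 2 σ).pow_right p).eq
          rw [pow_succ, Module.End.mul_apply, ← Module.End.mul_apply (obliqueD (-σ)), c1,
            Module.End.mul_apply, h2, map_sub, ← Module.End.mul_apply (partialD 2) (obliqueD σ ^ p),
            c2, Module.End.mul_apply, ← Module.End.mul_apply (partialD 2) (obliqueD σ ^ p),
            c2, Module.End.mul_apply]
        rw [h1, map_sub, map_smul, map_smul, ← Module.End.mul_apply (partialD 2 ^ l) (partialD 2),
          ← pow_succ, ← Module.End.mul_apply (partialD 2 ^ (l + 1)) (partialD 2), ← pow_succ]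
        exact Submodule.sub_mem _ (Submodule.smul_mem _ _ (mem_derivSpan κ hσ p l))
          (mem_derivSpan κ hσ p (l + 1 + 1))
  | zero => simp
  | add u v _ _ hu hv => rw [map_add]; exact Submodule.add_mem _ hu hv
  | smul c u _ hu => rw [map_smul]; exact Submodule.smul_mem _ c hu

/-- `derivSpan κ` is stable under differentiation, so it contains all derivatives of
`j_0(κ|y|)`. -/
theorem partialD_mem_derivSpan (κ : ℝ) (i : Fin 3) {w : SmoothFn} (hw : w ∈ derivSpan κ) :
    partialD i w ∈ derivSpan κ := by
  have h1 := obliqueD_mem_derivSpan κ Complex.I_mul_I hw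
  have h2 := obliqueD_mem_derivSpan κ (τ := -Complex.I) (by simp) hw
  simp only [obliqueD, LinearMap.add_apply, LinearMap.smul_apply] at h1 h2
  have e0 : partialD 0 w = (2 : ℂ)⁻¹ • ((partialD 0 w + Complex.I • partialD 1 w)
      + (partialD 0 w + (-Complex.I) • partialD 1 w)) := by
    module
  have e1 : partialD 1 w = (2 * Complex.I)⁻¹ • ((partialD 0 w + Complex.I • partialD 1 w)
      - (partialD 0 w + (-Complex.I) • partialD 1 w)) := by
    rw [eq_inv_smul_iff₀ (by simp)]
    module
  match i with
  | 0 => rw [e0]; exact Submodule.smul_mem _ _ (Submodule.add_mem _ h1 h2)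
  | 1 => rw [e1]; exact Submodule.smul_mem _ _ (Submodule.sub_mem _ h1 h2)
  | 2 => exact partialD_two_mem_derivSpan κ hw

/-- All derivatives of `j_0(κ|y|)` are combinations of multipoles. -/
theorem derivSpan_le {κ : ℝ} {M : Submodule ℂ SmoothFn}
    (hM : ∀ σ : ℂ, σ * σ = -1 → ∀ p d, mode κ σ p d ∈ M) : derivSpan κ ≤ M := by
  set M0 : Submodule ℂ SmoothFn :=
    Submodule.span ℂ {w | ∃ (σ : ℂ) (p d : ℕ), σ * σ = -1 ∧ w = mode κ σ p d} with hM0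
  have hmem : ∀ σ : ℂ, σ * σ = -1 → ∀ p d, mode κ σ p d ∈ M0 := fun σ hσ p d =>
    Submodule.subset_span ⟨σ, p, d, hσ, rfl⟩
  have hle : M0 ≤ M := by
    refine Submodule.span_le.2 ?_
    rintro w ⟨σ, p, d, hσ, rfl⟩
    exact hM σ hσ p d
  have hcl : ∀ w ∈ M0, partialD 2 w ∈ M0 := by
    intro w hw
    induction hw using Submodule.span_induction with
    | mem w hw =>
      obtain ⟨σ, p, d, hσ, rfl⟩ := hw
      rcases d with _ | d
      · rw [partialD_two_mode_zero]
        exact M0.smul_mem _ (hmem σ hσ p 1)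
      · rw [partialD_two_mode_succ]
        exact M0.add_mem (M0.smul_mem _ (hmem σ hσ p (d + 2))) (M0.smul_mem _ (hmem σ hσ p d))
    | zero => simp
    | add u v _ _ hu hv => rw [map_add]; exact Submodule.add_mem _ hu hv
    | smul c u _ hu => rw [map_smul]; exact Submodule.smul_mem _ c hu
  refine le_trans (Submodule.span_le.2 ?_) hle
  rintro w ⟨σ, p, l, hσ, rfl⟩
  rw [mode_zero_zero κ Complex.I σ, obliqueD_pow_mode κ hσ]
  induction l with
  | zero => exact M0.smul_mem _ (hmem σ hσ p 0)
  | succ l ih => rw [pow_succ', Module.End.mul_apply]; exact hcl _ ih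

/-! ### Integrals over the ball that depend on a parameter -/

section ParametricIntegral

open Metric

theorem integrableOn_mul_of_continuousOn {R : ℝ} {f K : E3 → ℂ} (hf : IntegrableOn f (ballR R))
    (hK : ContinuousOn K (closedBall 0 R)) : IntegrableOn (fun y => K y * f y) (ballR R) := by
  obtain ⟨C, hC⟩ := (isCompact_closedBall (0 : E3) R).exists_bound_of_continuousOn hK
  have hm : MeasurableSet (ballR R) := isOpen_ball.measurableSet
  refine Integrable.bdd_mul (c := C) hf
    ((hK.mono ball_subset_closedBall).aestronglyMeasurable hm) ?_
  exact (ae_restrict_mem hm).mono fun y hy => hC y (ball_subset_closedBall hy)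

theorem hasDerivAt_integral_mul {𝕜 : Type*} [RCLike 𝕜] [NormedAlgebra 𝕜 ℂ] {R : ℝ} {f : E3 → ℂ}
    (hf : IntegrableOn f (ballR R)) {K K' : 𝕜 → E3 → ℂ} {U : Set 𝕜} (hU : IsOpen U)
    (hK : ContinuousOn (fun q : 𝕜 × E3 => K q.1 q.2) (U ×ˢ closedBall 0 R))
    (hK' : ContinuousOn (fun q : 𝕜 × E3 => K' q.1 q.2) (U ×ˢ closedBall 0 R))
    (hd : ∀ z ∈ U, ∀ y ∈ closedBall (0 : E3) R, HasDerivAt (fun z => K z y) (K' z y) z)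
    {z : 𝕜} (hz : z ∈ U) :
    HasDerivAt (fun z => ∫ y in ballR R, K z y * f y) (∫ y in ballR R, K' z y * f y) z := by
  have hm : MeasurableSet (ballR R) := isOpen_ball.measurableSet
  have hslice : ∀ {L : 𝕜 → E3 → ℂ},
      ContinuousOn (fun q : 𝕜 × E3 => L q.1 q.2) (U ×ˢ closedBall 0 R) →
      ∀ w ∈ U, IntegrableOn (fun y => L w y * f y) (ballR R) := fun hL w hw =>
    integrableOn_mul_of_continuousOn hf
      (hL.comp (by fun_prop : ContinuousOn (fun y : E3 => (w, y)) _) fun y hy => ⟨hw, hy⟩)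
  obtain ⟨ε, hε, hεU⟩ := nhds_basis_closedBall.mem_iff.1 (hU.mem_nhds hz)
  obtain ⟨C, hC⟩ := ((isCompact_closedBall z ε).prod
    (isCompact_closedBall (0 : E3) R)).exists_bound_of_continuousOn
      (hK'.mono (Set.prod_mono hεU subset_rfl))
  refine (hasDerivAt_integral_of_dominated_loc_of_deriv_le (F := fun z y => K z y * f y)
    (F' := fun z y => K' z y * f y)
    (bound := fun y => C * ‖f y‖)
    (closedBall_mem_nhds z hε) ?_ (hslice hK z hz) (hslice hK' z hz).aestronglyMeasurable ?_
    (hf.norm.const_mul C) ?_).2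
  · filter_upwards [hU.mem_nhds hz] with w hw
    exact (hslice hK w hw).aestronglyMeasurable
  · filter_upwards [ae_restrict_mem hm] with y hy w hw
    rw [norm_mul]
    exact mul_le_mul_of_nonneg_right (hC (w, y) ⟨hw, ball_subset_closedBall hy⟩) (norm_nonneg _)
  · filter_upwards [ae_restrict_mem hm] with y hy w hw
    exact (hd w (hεU hw) y (ball_subset_closedBall hy)).mul_const _

theorem analyticOnNhd_integral_mul {R : ℝ} {f : E3 → ℂ}
    (hf : IntegrableOn f (ballR R)) {K K' : ℂ → E3 → ℂ} {U : Set ℂ} (hU : IsOpen U)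
    (hK : ContinuousOn (fun q : ℂ × E3 => K q.1 q.2) (U ×ˢ closedBall 0 R))
    (hK' : ContinuousOn (fun q : ℂ × E3 => K' q.1 q.2) (U ×ˢ closedBall 0 R))
    (hd : ∀ z ∈ U, ∀ y ∈ closedBall (0 : E3) R, HasDerivAt (fun z => K z y) (K' z y) z) :
    AnalyticOnNhd ℂ (fun z => ∫ y in ballR R, K z y * f y) U :=
  DifferentiableOn.analyticOnNhd (fun _ hz =>
    (hasDerivAt_integral_mul hf hU hK hK' hd hz).differentiableAt.differentiableWithinAt) hU

end ParametricIntegral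

/-! ### Moments against the derivatives of `j_0(κ|y|)` and the field `∫ j_0(κ|x - y|) f(y) dy` -/

/-- The field `x ↦ ∫_{B_R} w(y - x) f(y) dy`. -/
noncomputable def translateIntegral (R : ℝ) (f : E3 → ℂ) (w : E3 → ℂ) (x : E3) : ℂ :=
  ∫ y in ballR R, w (y - x) * f y

theorem hasDerivAt_translateIntegral {R : ℝ} {f : E3 → ℂ} (hf : IntegrableOn f (ballR R))
    {w : E3 → ℂ} (hw : ContDiff ℝ ∞ w) (a x : E3) (t : ℝ) :
    HasDerivAt (fun t : ℝ => translateIntegral R f w (a + t • x))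
      (translateIntegral R f (fun y => -(fderiv ℝ w y x)) (a + t • x)) t := by
  have hw' : Continuous fun y => fderiv ℝ w y x :=
    ((hw.continuous_fderiv (by simp)).clm_apply continuous_const)
  refine hasDerivAt_integral_mul hf (K := fun (t : ℝ) y => w (y - (a + t • x)))
    (K' := fun (t : ℝ) y => -(fderiv ℝ w (y - (a + t • x)) x)) isOpen_univ ?_ ?_ ?_
    (Set.mem_univ t)
  · have := hw.continuous
    fun_prop
  · refine Continuous.continuousOn ?_
    have h : Continuous fun q : ℝ × E3 => q.2 - (a + q.1 • x) := by fun_prop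
    exact (hw'.comp h).neg
  · intro s _ y _
    have h1 : HasDerivAt (fun t : ℝ => y - (a + t • x)) (-x) s := by
      simpa using (((hasDerivAt_id s).smul_const x).const_add a).const_sub y
    have h2 := ((hw.differentiable (by simp) (y - (a + s • x))).hasFDerivAt).comp_hasDerivAt s h1
    rw [map_neg] at h2
    exact h2

theorem translateIntegral_add {R : ℝ} {f : E3 → ℂ} (hf : IntegrableOn f (ballR R)) (u v : SmoothFn)
    (x : E3) : translateIntegral R f ((u + v : SmoothFn) : E3 → ℂ) x
      = translateIntegral R f u x + translateIntegral R f v x := by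
  have h : ∀ u : SmoothFn, IntegrableOn (fun y => u.1 (y - x) * f y) (ballR R) := fun u =>
    integrableOn_mul_of_continuousOn hf
      ((contDiff_smoothFn u).continuous.comp (continuous_id.sub continuous_const)).continuousOn
  unfold translateIntegral
  rw [← integral_add (h u) (h v)]
  exact integral_congr_ae (Filter.Eventually.of_forall fun y => add_mul _ _ _)

theorem translateIntegral_smul (R : ℝ) (f : E3 → ℂ) (c : ℂ) (u : SmoothFn) (x : E3) :
    translateIntegral R f ((c • u : SmoothFn) : E3 → ℂ) x = c * translateIntegral R f u x := by
  unfold translateIntegral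
  rw [← integral_const_mul]
  exact integral_congr_ae (Filter.Eventually.of_forall fun y => mul_assoc _ _ _)

/-- The smooth functions `w` for which the field `∫_{B_R} w(y - x) f(y) dy` vanishes on a set of
points `x`. -/
noncomputable def fieldAnnihilator {R : ℝ} {f : E3 → ℂ} (hf : IntegrableOn f (ballR R))
    (S : Set E3) : Submodule ℂ SmoothFn where
  carrier := {w | ∀ x ∈ S, translateIntegral R f w x = 0}
  add_mem' hu hv x hx := by rw [translateIntegral_add hf, hu x hx, hv x hx, add_zero]
  zero_mem' x _ := by simp [translateIntegral]
  smul_mem' c u hu x hx := by rw [translateIntegral_smul, hu x hx, mul_zero]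

theorem mem_fieldAnnihilator {R : ℝ} {f : E3 → ℂ} {hf : IntegrableOn f (ballR R)} {S : Set E3}
    {w : SmoothFn} : w ∈ fieldAnnihilator hf S ↔ ∀ x ∈ S, translateIntegral R f w x = 0 := Iff.rfl

theorem partialD_mem_fieldAnnihilator {R : ℝ} {f : E3 → ℂ} (hf : IntegrableOn f (ballR R))
    (i : Fin 3) {w : SmoothFn} (hw : w ∈ fieldAnnihilator hf Set.univ) :
    partialD i w ∈ fieldAnnihilator hf Set.univ := by
  intro x _
  have h := hasDerivAt_translateIntegral hf (contDiff_smoothFn w) x (EuclideanSpace.single i 1) 0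
  have h0 : (fun t : ℝ => translateIntegral R f w (x + t • EuclideanSpace.single i (1 : ℝ)))
      = fun _ => 0 := funext fun t => hw _ (Set.mem_univ _)
  rw [h0] at h
  have h1 := h.unique (hasDerivAt_const (0 : ℝ) (0 : ℂ))
  have h2 : translateIntegral R f (fun y => -(fderiv ℝ w.1 y (EuclideanSpace.single i 1))) x
      = - translateIntegral R f (partialD i w) x := by
    unfold translateIntegral
    rw [← integral_neg]
    exact integral_congr_ae (Filter.Eventually.of_forall fun y => neg_mul _ _)
  rw [zero_smul, add_zero, h2] at h1
  exact neg_eq_zero.1 h1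

/-- The directional derivative `-x·∇` on smooth functions. -/
noncomputable def negDirD (x : E3) : Module.End ℂ SmoothFn :=
  -∑ i, (x i : ℂ) • partialD i

theorem negDirD_apply (x : E3) (w : SmoothFn) (y : E3) :
    (negDirD x w : E3 → ℂ) y = -(fderiv ℝ w.1 y x) := by
  have hx : x = ∑ i, x i • EuclideanSpace.single i (1 : ℝ) := by
    ext j
    fin_cases j <;> simp [Fin.sum_univ_three]
  have h1 : (negDirD x w : E3 → ℂ) y = -∑ i, (x i : ℂ) * pderiv i w.1 y := by
    simp only [negDirD, Fin.sum_univ_three]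
    rfl
  rw [h1]
  conv_rhs => rw [hx]
  rw [map_sum]
  congr 1
  refine Finset.sum_congr rfl fun i _ => ?_
  rw [map_smul]
  simp [pderiv]

theorem analyticOnNhd_translateIntegral_mode {R : ℝ} {f : E3 → ℂ} (hf : IntegrableOn f (ballR R))
    (κ : ℝ) (σ : ℂ) (x : E3) :
    AnalyticOnNhd ℝ (fun t : ℝ => translateIntegral R f (modeFn κ σ 0 0) (t • x)) Set.univ := by
  have hH : AnalyticOnNhd ℂ (fun z : ℂ => ∫ y in ballR R, besselEntire 0
      (κ ^ 2 * ((‖y‖ ^ 2 : ℝ) - 2 * z * (inner ℝ y x : ℝ) + z ^ 2 * (‖x‖ ^ 2 : ℝ))) * f y)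
      Set.univ := by
    have hc : ∀ n, Continuous (besselEntire n) := fun n =>
      continuous_iff_continuousAt.2 fun s => (hasDerivAt_besselEntire n s).continuousAt
    have h0 := hc 0
    have h1 := hc 1
    refine analyticOnNhd_integral_mul hf (K' := fun z y => -(1 / 2) * besselEntire 1
      (κ ^ 2 * ((‖y‖ ^ 2 : ℝ) - 2 * z * (inner ℝ y x : ℝ) + z ^ 2 * (‖x‖ ^ 2 : ℝ))) *
      (κ ^ 2 * (-2 * (inner ℝ y x : ℝ) + 2 * z * (‖x‖ ^ 2 : ℝ)))) isOpen_univ ?_ ?_ ?_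
    · fun_prop
    · fun_prop
    · intro z _ y _
      refine (hasDerivAt_besselEntire 0 _).comp z ?_
      have := ((((hasDerivAt_id z).const_mul (2 : ℂ)).mul_const ((inner ℝ y x : ℝ) : ℂ)).const_sub
        ((‖y‖ ^ 2 : ℝ) : ℂ)).add (((hasDerivAt_id z).pow 2).mul_const ((‖x‖ ^ 2 : ℝ) : ℂ))
      refine (this.const_mul ((κ : ℂ) ^ 2)).congr_deriv ?_
      simp
  have h2 : AnalyticOnNhd ℝ (fun t : ℝ => (t : ℂ)) Set.univ := Complex.ofRealCLM.analyticOnNhd _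
  refine ((hH.restrictScalars (𝕜 := ℝ)).comp h2 (Set.mapsTo_univ _ _)).congr isOpen_univ ?_
  intro t _
  simp only [Function.comp, translateIntegral, modeFn, zonalPoly]
  refine integral_congr_ae (Filter.Eventually.of_forall fun y => ?_)
  simp only [norm_sub_sq_real, inner_smul_right, norm_smul, mul_pow]
  simp
  left
  congr 1
  ring

/-- The moments of `f` against all derivatives of `j_0(κ|y|)` vanish if and only if the field
`∫ j_0(κ|x - y|) f(y) dy` vanishes far away: those moments are the Taylor coefficients at `x = 0` of
this field, which is real analytic on lines. -/
theorem moments_eq_zero_iff {R : ℝ} {f : E3 → ℂ} (hf : IntegrableOn f (ballR R)) {κ : ℝ}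
    (hκ : κ ≠ 0) :
    (∀ σ : ℂ, σ * σ = -1 → ∀ p d, ∫ y in ballR R, modeFn κ σ p d y * f y = 0) ↔
      ∀ x : E3, R < ‖x‖ → translateIntegral R f (modeFn κ Complex.I 0 0) x = 0 := by
  constructor
  · intro h x _
    have hle : derivSpan κ ≤ fieldAnnihilator hf {0} := by
      refine derivSpan_le fun σ hσ p d => mem_fieldAnnihilator.2 ?_
      rintro _ rfl
      simpa [translateIntegral] using h σ hσ p d
    set W : ℕ → SmoothFn := fun k => (negDirD x ^ k) (mode κ Complex.I 0 0) with hW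
    have hWs : ∀ k, W (k + 1) = negDirD x (W k) := fun k => by
      simp only [hW, pow_succ', Module.End.mul_apply]
    have hWm : ∀ k, W k ∈ derivSpan κ := by
      intro k
      induction k with
      | zero => simpa [hW] using mem_derivSpan κ Complex.I_mul_I 0 0
      | succ k ih =>
        rw [hWs, negDirD, LinearMap.neg_apply, LinearMap.sum_apply]
        refine Submodule.neg_mem _ (Submodule.sum_mem _ fun i _ => ?_)
        exact Submodule.smul_mem _ _ (partialD_mem_derivSpan κ i ih)
    have hder : ∀ k, deriv (fun t : ℝ => translateIntegral R f (W k) (t • x))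
        = fun t : ℝ => translateIntegral R f (W (k + 1)) (t • x) := by
      intro k
      ext t
      have := hasDerivAt_translateIntegral hf (contDiff_smoothFn (W k)) 0 x t
      simp only [zero_add] at this
      rw [this.deriv, hWs]
      congr 1
      ext y
      rw [negDirD_apply]
    have hit : ∀ k, iteratedDeriv k
        (fun t : ℝ => translateIntegral R f (modeFn κ Complex.I 0 0) (t • x))
        = fun t : ℝ => translateIntegral R f (W k) (t • x) := by
      intro k
      induction k with
      | zero => rw [iteratedDeriv_zero]; rfl
      | succ k ih => rw [iteratedDeriv_succ, ih, hder]
    have han := analyticOnNhd_translateIntegral_mode hf κ Complex.I x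
    have hev : (fun t : ℝ => translateIntegral R f (modeFn κ Complex.I 0 0) (t • x))
        =ᶠ[nhds 0] 0 := by
      refine analyticOrderAt_eq_top.1 (ENat.eq_top_iff_forall_ge.2 fun n => ?_)
      refine (natCast_le_analyticOrderAt_iff_iteratedDeriv_eq_zero (han 0 (Set.mem_univ _))).2 ?_
      intro k _
      rw [hit]
      exact mem_fieldAnnihilator.1 (hle (hWm k)) _ (by simp)
    have := han.eqOn_zero_of_preconnected_of_eventuallyEq_zero isPreconnected_univ
      (Set.mem_univ _) hev (Set.mem_univ 1)
    simpa using this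
  · intro h σ hσ p d
    have hmem : mode κ Complex.I 0 0 ∈ fieldAnnihilator hf Set.univ := by
      intro x _
      -- The field vanishes on the part of a line outside the ball, so on the whole line.
      obtain ⟨e, s, hes, he⟩ : ∃ (e : E3) (s : ℝ), x = s • e ∧ 0 < ‖e‖ := by
        by_cases hx : x = 0
        · exact ⟨EuclideanSpace.single 0 1, 0, by simp [hx], by simp⟩
        · exact ⟨x, 1, by simp, norm_pos_iff.2 hx⟩
      have han := analyticOnNhd_translateIntegral_mode hf κ Complex.I e
      have hev : (fun t : ℝ => translateIntegral R f (modeFn κ Complex.I 0 0) (t • e))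
          =ᶠ[nhds (|R| / ‖e‖ + 1)] 0 := by
        have : ∀ᶠ t in nhds (|R| / ‖e‖ + 1), |R| / ‖e‖ < t :=
          lt_mem_nhds (by linarith)
        filter_upwards [this] with t ht
        refine h _ ?_
        rw [norm_smul, Real.norm_eq_abs]
        rw [div_lt_iff₀ he] at ht
        calc R ≤ |R| := le_abs_self R
          _ < t * ‖e‖ := ht
          _ ≤ |t| * ‖e‖ := by gcongr; exact le_abs_self t
      rw [hes]
      exact han.eqOn_zero_of_preconnected_of_eventuallyEq_zero isPreconnected_univ
        (Set.mem_univ _) hev (Set.mem_univ s)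
    have := mode_mem_of_partialD_mem hκ (fun i w hw => partialD_mem_fieldAnnihilator hf i hw)
      hmem hσ p d
    simpa [translateIntegral] using mem_fieldAnnihilator.1 this 0 (Set.mem_univ _)

open Metric

/-! ### The outgoing field near infinity as a holomorphic function of `1/|x|` -/

/-- `|θ - z y|²` for a unit vector `θ`, continued to complex `z`. -/
noncomputable def farQuad (θ y : E3) (z : ℂ) : ℂ :=
  1 - 2 * z * (inner ℝ θ y : ℝ) + z ^ 2 * (‖y‖ ^ 2 : ℝ)

/-- The distance `|θ - z y|` for a unit vector `θ`, continued to `|z| |y| < 1`. -/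
noncomputable def farDist (θ y : E3) (z : ℂ) : ℂ := Complex.exp (Complex.log (farQuad θ y z) / 2)

/-- The difference `|x - y| - |x|` of distances, for `x = z⁻¹ θ`, continued to `|z| |y| < 1`. It is
`(|θ - z y| - 1) / z`, in a form that is regular at `z = 0`. -/
noncomputable def farPhase (θ y : E3) (z : ℂ) : ℂ :=
  (-2 * (inner ℝ θ y : ℝ) + z * (‖y‖ ^ 2 : ℝ)) / (farDist θ y z + 1)

/-- The kernel `|x| e^{-iκ|x|} · e^{iκ|x - y|} / |x - y|`, for `x = z⁻¹ θ`, continued to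
`|z| |y| < 1`. -/
noncomputable def farKernel (κ : ℝ) (θ y : E3) (z : ℂ) : ℂ :=
  Complex.exp (Complex.I * κ * farPhase θ y z) / farDist θ y z

theorem farQuad_mem_slitPlane {θ y : E3} {z : ℂ} (hθ : ‖θ‖ = 1) (hz : ‖z‖ * ‖y‖ < 1) :
    farQuad θ y z ∈ Complex.slitPlane := by
  have ht : |inner ℝ θ y| ≤ ‖y‖ := by
    simpa [hθ] using abs_real_inner_le_norm θ y
  have hs := norm_nonneg y
  have hz2 : ‖z‖ ^ 2 = z.re ^ 2 + z.im ^ 2 := by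
    rw [← Complex.normSq_eq_norm_sq, Complex.normSq_apply]; ring
  have hlt : (z.re ^ 2 + z.im ^ 2) * ‖y‖ ^ 2 < 1 := by
    rw [← hz2, ← mul_pow]
    exact pow_lt_one₀ (by positivity) hz two_ne_zero
  have hre : (farQuad θ y z).re = 1 - 2 * z.re * inner ℝ θ y
      + (z.re ^ 2 - z.im ^ 2) * ‖y‖ ^ 2 := by
    simp [farQuad, pow_two]
  have him : (farQuad θ y z).im = 2 * z.im * (z.re * ‖y‖ ^ 2 - inner ℝ θ y) := by
    simp [farQuad, pow_two]; ring
  rw [Complex.mem_slitPlane_iff]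
  by_contra! hcon
  obtain ⟨h1, h2⟩ := hcon
  rw [him] at h2
  rw [hre] at h1
  generalize inner ℝ θ y = t at *
  rcases mul_eq_zero.1 h2 with h3 | h3
  · -- For real `z` the value is at least `(1 - |z| |y|)²`.
    have h4 : z.im = 0 := by simpa using h3
    rw [h4] at h1 hlt
    have h5 : (z.re * t) ≤ |z.re| * ‖y‖ := by
      calc z.re * t ≤ |z.re * t| := le_abs_self _
        _ = |z.re| * |t| := abs_mul _ _
        _ ≤ |z.re| * ‖y‖ := by gcongr
    have h6 : |z.re| * ‖y‖ < 1 := lt_of_le_of_lt (by gcongr; exact Complex.abs_re_le_norm z) hz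
    have h7 : |z.re| ^ 2 = z.re ^ 2 := sq_abs _
    nlinarith [mul_pos (sub_pos.2 h6) (sub_pos.2 h6)]
  · -- Otherwise the value is real only if it equals `1 - |z|² |y|²`.
    have h4 : t = z.re * ‖y‖ ^ 2 := by linarith
    rw [h4] at h1
    nlinarith

theorem farDist_sq {θ y : E3} {z : ℂ} (h : farQuad θ y z ∈ Complex.slitPlane) :
    farDist θ y z ^ 2 = farQuad θ y z := by
  rw [farDist, ← Complex.exp_nat_mul]
  rw [show ((2 : ℕ) : ℂ) * (Complex.log (farQuad θ y z) / 2) = Complex.log (farQuad θ y z) by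
    push_cast; ring]
  exact Complex.exp_log (Complex.slitPlane_ne_zero h)

theorem farDist_ne_zero (θ y : E3) (z : ℂ) : farDist θ y z ≠ 0 := Complex.exp_ne_zero _

theorem farDist_re_pos {θ y : E3} {z : ℂ} (h : farQuad θ y z ∈ Complex.slitPlane) :
    0 < (farDist θ y z).re := by
  rw [farDist, Complex.exp_re]
  have h1 : (Complex.log (farQuad θ y z) / 2).im = (farQuad θ y z).arg / 2 := by
    rw [Complex.div_ofNat_im, Complex.log_im]
  rw [h1]
  have h2 := Complex.mem_slitPlane_iff_arg.1 h
  have h3 := Complex.neg_pi_lt_arg (farQuad θ y z)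
  have h4 := lt_of_le_of_ne (Complex.arg_le_pi (farQuad θ y z)) h2.1
  exact mul_pos (Real.exp_pos _) (Real.cos_pos_of_mem_Ioo ⟨by linarith, by linarith⟩)

theorem farDist_add_one_ne_zero {θ y : E3} {z : ℂ} (h : farQuad θ y z ∈ Complex.slitPlane) :
    farDist θ y z + 1 ≠ 0 := fun h0 => by
  have h1 := farDist_re_pos h
  have h2 := congrArg Complex.re h0
  simp at h2
  linarith

theorem farDist_ofReal {θ y : E3} {z : ℝ} (hθ : ‖θ‖ = 1)
    (h : farQuad θ y z ∈ Complex.slitPlane) : farDist θ y z = (‖θ - z • y‖ : ℂ) := by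
  have h1 : farQuad θ y z = ((‖θ - z • y‖ : ℂ)) ^ 2 := by
    have : ‖θ - z • y‖ ^ 2 = 1 - 2 * z * inner ℝ θ y + z ^ 2 * ‖y‖ ^ 2 := by
      rw [norm_sub_sq_real, inner_smul_right, norm_smul, mul_pow, hθ, Real.norm_eq_abs, sq_abs]
      ring
    rw [← Complex.ofReal_pow, this, farQuad]
    push_cast
    ring
  have h2 := farDist_sq h
  rw [h1] at h2
  rcases sq_eq_sq_iff_eq_or_eq_neg.1 h2 with h3 | h3
  · exact h3
  · have h4 := farDist_re_pos h
    rw [h3] at h4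
    simp at h4
    linarith [norm_nonneg (θ - z • y)]

theorem exp_dist_eq_farKernel (κ : ℝ) {θ y : E3} {ρ : ℝ} (hθ : ‖θ‖ = 1) (hy : ‖y‖ < ρ) :
    Complex.exp (Complex.I * κ * ‖ρ • θ - y‖) / (‖ρ • θ - y‖ : ℂ) =
      Complex.exp (Complex.I * κ * ρ) * (ρ : ℂ)⁻¹ * farKernel κ θ y ((ρ⁻¹ : ℝ) : ℂ) := by
  have hρ : 0 < ρ := (norm_nonneg y).trans_lt hy
  have hρc : (ρ : ℂ) ≠ 0 := by exact_mod_cast hρ.ne'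
  have hz : ‖((ρ⁻¹ : ℝ) : ℂ)‖ * ‖y‖ < 1 := by
    rw [Complex.norm_real, Real.norm_eq_abs, abs_of_pos (inv_pos.2 hρ), inv_mul_lt_iff₀ hρ]
    simpa using hy
  have hq := farQuad_mem_slitPlane hθ hz
  have hd := farDist_ofReal hθ hq
  have hn : ‖ρ • θ - y‖ = ρ * ‖θ - ρ⁻¹ • y‖ := by
    rw [← abs_of_pos hρ, ← Real.norm_eq_abs, ← norm_smul, Real.norm_eq_abs, abs_of_pos hρ,
      smul_sub, smul_inv_smul₀ hρ.ne']
  have hdist : (‖ρ • θ - y‖ : ℂ) = ρ * farDist θ y ((ρ⁻¹ : ℝ) : ℂ) := by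
    rw [hn, hd]; push_cast; ring
  have hph : (ρ : ℂ) * farDist θ y ((ρ⁻¹ : ℝ) : ℂ) = ρ + farPhase θ y ((ρ⁻¹ : ℝ) : ℂ) := by
    have h1 := farDist_add_one_ne_zero hq
    have h2 := farDist_sq hq
    rw [farPhase, ← sub_eq_iff_eq_add', eq_div_iff h1]
    rw [farQuad] at h2
    push_cast at *
    generalize farDist θ y ((ρ : ℂ)⁻¹) = w at *
    have h3 : (ρ : ℂ) * (w ^ 2 - 1) = -2 * (inner ℝ θ y : ℝ) + (ρ : ℂ)⁻¹ * (‖y‖ : ℂ) ^ 2 := by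
      rw [h2]
      field_simp
      ring
    linear_combination h3
  rw [hdist, farKernel, hph, mul_add, Complex.exp_add, ← hph]
  have := farDist_ne_zero θ y ((ρ⁻¹ : ℝ) : ℂ)
  field_simp

theorem farKernel_neg (κ : ℝ) (θ y : E3) (z : ℂ) :
    farKernel κ θ y (-z) = farKernel (-κ) (-θ) y z := by
  have h1 : farQuad θ y (-z) = farQuad (-θ) y z := by
    simp [farQuad, inner_neg_left]
  have h2 : farDist θ y (-z) = farDist (-θ) y z := by rw [farDist, h1, farDist]
  have h3 : farPhase θ y (-z) = -farPhase (-θ) y z := by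
    rw [farPhase, farPhase, h2, ← neg_div]
    congr 1
    simp [inner_neg_left]
    ring
  rw [farKernel, farKernel, h2, h3]
  congr 2
  push_cast
  ring

/-- The function `z ↦ ∫ farKernel f`, which at `z = 1/ρ` is, up to the factor `e^{iκρ}/ρ`, the field
`∫ e^{iκ|x - y|} / |x - y| f(y) dy` at the point `x = ρ θ`. -/
noncomputable def farIntegral (κ R : ℝ) (f : E3 → ℂ) (θ : E3) (z : ℂ) : ℂ :=
  ∫ y in ballR R, farKernel κ θ y z * f y

theorem analyticOnNhd_farIntegral {R : ℝ} (hR : 0 < R) {f : E3 → ℂ} (hf : IntegrableOn f (ballR R))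
    (κ : ℝ) {θ : E3} (hθ : ‖θ‖ = 1) :
    AnalyticOnNhd ℂ (farIntegral κ R f θ) (ball 0 R⁻¹) := by
  have hsl : ∀ z ∈ ball (0 : ℂ) R⁻¹, ∀ y ∈ closedBall (0 : E3) R,
      farQuad θ y z ∈ Complex.slitPlane := by
    intro z hz y hy
    rw [mem_ball_zero_iff] at hz
    rw [mem_closedBall_zero_iff] at hy
    refine farQuad_mem_slitPlane hθ ?_
    calc ‖z‖ * ‖y‖ ≤ ‖z‖ * R := by gcongr
      _ < R⁻¹ * R := by gcongr
      _ = 1 := inv_mul_cancel₀ hR.ne'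
  set dQ : ℂ → E3 → ℂ := fun z y => -2 * (inner ℝ θ y : ℝ) + 2 * z * (‖y‖ ^ 2 : ℝ) with hdQ
  set dW : ℂ → E3 → ℂ := fun z y =>
    farDist θ y z * (dQ z y / farQuad θ y z / 2) with hdW
  set dP : ℂ → E3 → ℂ := fun z y => ((‖y‖ ^ 2 : ℝ) * (farDist θ y z + 1)
    - (-2 * (inner ℝ θ y : ℝ) + z * (‖y‖ ^ 2 : ℝ)) * dW z y) / (farDist θ y z + 1) ^ 2 with hdP
  set S := ball (0 : ℂ) R⁻¹ ×ˢ closedBall (0 : E3) R with hS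
  have cQ : ContinuousOn (fun q : ℂ × E3 => farQuad θ q.2 q.1) S := by
    unfold farQuad; fun_prop
  have cdQ : ContinuousOn (fun q : ℂ × E3 => dQ q.1 q.2) S := by
    simp only [hdQ]; fun_prop
  have cW : ContinuousOn (fun q : ℂ × E3 => farDist θ q.2 q.1) S := by
    unfold farDist
    exact ((cQ.clog fun q hq => hsl q.1 hq.1 q.2 hq.2).div_const 2).cexp
  have cdW : ContinuousOn (fun q : ℂ × E3 => dW q.1 q.2) S :=
    cW.mul ((cdQ.div cQ fun q hq =>
      Complex.slitPlane_ne_zero (hsl q.1 hq.1 q.2 hq.2)).div_const 2)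
  have cN : ContinuousOn (fun q : ℂ × E3 =>
      (-2 * (inner ℝ θ q.2 : ℝ) + q.1 * (‖q.2‖ ^ 2 : ℝ) : ℂ)) S := by fun_prop
  have cs : ContinuousOn (fun q : ℂ × E3 => ((‖q.2‖ ^ 2 : ℝ) : ℂ)) S := by fun_prop
  have hw1 : ∀ q ∈ S, farDist θ q.2 q.1 + 1 ≠ 0 := fun q hq =>
    farDist_add_one_ne_zero (hsl q.1 hq.1 q.2 hq.2)
  have cW1 : ContinuousOn (fun q : ℂ × E3 => farDist θ q.2 q.1 + 1) S := cW.add continuousOn_const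
  have cP : ContinuousOn (fun q : ℂ × E3 => farPhase θ q.2 q.1) S := cN.div cW1 hw1
  have cdP : ContinuousOn (fun q : ℂ × E3 => dP q.1 q.2) S :=
    ((cs.mul cW1).sub (cN.mul cdW)).div (cW1.pow 2) fun q hq => pow_ne_zero 2 (hw1 q hq)
  have cE : ContinuousOn (fun q : ℂ × E3 => Complex.exp (Complex.I * κ * farPhase θ q.2 q.1)) S :=
    (continuousOn_const.mul cP).cexp
  refine analyticOnNhd_integral_mul hf (K' := fun z y =>
    (Complex.exp (Complex.I * κ * farPhase θ y z) * (Complex.I * κ * dP z y) * farDist θ y z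
      - Complex.exp (Complex.I * κ * farPhase θ y z) * dW z y) / farDist θ y z ^ 2) isOpen_ball
    (cE.div cW fun q _ => farDist_ne_zero _ _ _)
    ((((cE.mul (continuousOn_const.mul cdP)).mul cW).sub (cE.mul cdW)).div (cW.pow 2)
      fun q _ => pow_ne_zero 2 (farDist_ne_zero _ _ _)) ?_
  intro z hz y hy
  have hq := hsl z hz y hy
  have dq : HasDerivAt (farQuad θ y) (dQ z y) z := by
    have := ((((hasDerivAt_id z).const_mul (2 : ℂ)).mul_const ((inner ℝ θ y : ℝ) : ℂ)).const_sub
        1).add (((hasDerivAt_id z).pow 2).mul_const ((‖y‖ ^ 2 : ℝ) : ℂ))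
    refine this.congr_deriv ?_
    simp [hdQ]
  have dw : HasDerivAt (farDist θ y) (dW z y) z := ((dq.clog hq).div_const 2).cexp
  have dn : HasDerivAt (fun z : ℂ => -2 * ((inner ℝ θ y : ℝ) : ℂ) + z * ((‖y‖ ^ 2 : ℝ) : ℂ))
      ((‖y‖ ^ 2 : ℝ) : ℂ) z := by
    exact (((hasDerivAt_id z).mul_const ((‖y‖ ^ 2 : ℝ) : ℂ)).const_add
      (-2 * ((inner ℝ θ y : ℝ) : ℂ))).congr_deriv (one_mul _)
  have dp : HasDerivAt (farPhase θ y) (dP z y) z :=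
    dn.div (dw.add_const 1) (farDist_add_one_ne_zero hq)
  exact ((dp.const_mul (Complex.I * κ)).cexp).div dw (farDist_ne_zero θ y z)

/-- The field `∫ e^{iκ|x - y|} / |x - y| f(y) dy`. -/
noncomputable def outgoingField (κ R : ℝ) (f : E3 → ℂ) (x : E3) : ℂ :=
  ∫ y in ballR R, Complex.exp (Complex.I * κ * ‖x - y‖) / (‖x - y‖ : ℂ) * f y

theorem outgoingField_eq (κ : ℝ) {R : ℝ} (f : E3 → ℂ) {θ : E3} (hθ : ‖θ‖ = 1) {ρ : ℝ}
    (hρ : R < ρ) : outgoingField κ R f (ρ • θ) =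
      Complex.exp (Complex.I * κ * ρ) * (ρ : ℂ)⁻¹ * farIntegral κ R f θ ((ρ⁻¹ : ℝ) : ℂ) := by
  rw [outgoingField, farIntegral, ← integral_const_mul]
  refine setIntegral_congr_fun isOpen_ball.measurableSet fun y hy => ?_
  have hy' : ‖y‖ < R := by simpa [ballR] using hy
  beta_reduce
  rw [exp_dist_eq_farKernel κ hθ (hy'.trans hρ), mul_assoc]

theorem farIntegral_neg (κ R : ℝ) (f : E3 → ℂ) (θ : E3) (z : ℂ) :
    farIntegral κ R f θ (-z) = farIntegral (-κ) R f (-θ) z := by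
  simp only [farIntegral, farKernel_neg]

theorem outgoingField_sub {κ R : ℝ} {f : E3 → ℂ} (hf : IntegrableOn f (ballR R))
    {x : E3} (hx : R < ‖x‖) :
    outgoingField κ R f x - outgoingField (-κ) R f x =
      2 * Complex.I * κ * translateIntegral R f (modeFn κ Complex.I 0 0) x := by
  have hne : ∀ y ∈ closedBall (0 : E3) R, (‖x - y‖ : ℂ) ≠ 0 := by
    intro y hy h0
    rw [mem_closedBall_zero_iff] at hy
    have : x = y := by simpa [sub_eq_zero] using h0
    rw [this] at hx
    linarith
  have hint : ∀ κ : ℝ, IntegrableOn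
      (fun y => Complex.exp (Complex.I * κ * ‖x - y‖) / (‖x - y‖ : ℂ) * f y) (ballR R) := by
    intro κ
    refine integrableOn_mul_of_continuousOn hf (ContinuousOn.div ?_ ?_ hne) <;> fun_prop
  rw [outgoingField, outgoingField, ← integral_sub (hint κ) (hint (-κ)), translateIntegral,
    ← integral_const_mul]
  refine setIntegral_congr_fun isOpen_ball.measurableSet fun y hy => ?_
  have hr := hne y (ball_subset_closedBall hy)
  have hs := mul_besselEntire_zero ((κ * ‖x - y‖ : ℝ) : ℂ)
  simp only [modeFn, zonalPoly]
  rw [norm_sub_rev y x]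
  push_cast at hs ⊢
  rw [mul_pow] at hs
  simp only [Complex.sin] at hs
  simp only [pow_zero, mul_one]
  have e1 : Complex.I * κ * ‖x - y‖ = (κ : ℂ) * ‖x - y‖ * Complex.I := by ring
  have e2 : Complex.I * -κ * ‖x - y‖ = -((κ : ℂ) * ‖x - y‖) * Complex.I := by ring
  rw [e1, e2, ← sub_mul, ← sub_div, div_mul_eq_mul_div, div_eq_iff hr]
  linear_combination (-2 * Complex.I * f y) * hs + (Complex.exp ((κ : ℂ) * ‖x - y‖ * Complex.I)
    - Complex.exp (-((κ : ℂ) * ‖x - y‖) * Complex.I)) * f y * Complex.I_sq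

open Filter Topology

/-! ### Comparison of the outgoing field with the field of the regular kernel -/

theorem exists_polar {x : E3} (hx : x ≠ 0) : ∃ θ : E3, ‖θ‖ = 1 ∧ x = ‖x‖ • θ :=
  ⟨‖x‖⁻¹ • x, by rw [norm_smul, norm_inv, norm_norm, inv_mul_cancel₀ (norm_ne_zero_iff.2 hx)],
    (smul_inv_smul₀ (norm_ne_zero_iff.2 hx) x).symm⟩

theorem norm_ofReal_smul_unit {θ : E3} (hθ : ‖θ‖ = 1) {ρ : ℝ} (hρ : 0 < ρ) : ‖ρ • θ‖ = ρ := by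
  rw [norm_smul, hθ, mul_one, Real.norm_eq_abs, abs_of_pos hρ]

theorem tendsto_inv_ofReal_nhdsNE :
    Tendsto (fun ρ : ℝ => ((ρ⁻¹ : ℝ) : ℂ)) atTop (𝓝[≠] 0) := by
  refine tendsto_nhdsWithin_iff.2 ⟨?_, ?_⟩
  · have := (Complex.continuous_ofReal.tendsto 0).comp tendsto_inv_atTop_zero
    simpa [Function.comp_def] using this
  · filter_upwards [eventually_gt_atTop 0] with ρ hρ
    simpa using hρ.ne'

theorem farIntegral_eq_zero_iff {κ R : ℝ} (hR : 0 < R) {f : E3 → ℂ}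
    (hf : IntegrableOn f (ballR R)) {θ : E3} (hθ : ‖θ‖ = 1) :
    (∀ ρ : ℝ, R < ρ → outgoingField κ R f (ρ • θ) = 0) ↔
      Set.EqOn (farIntegral κ R f θ) 0 (ball 0 R⁻¹) := by
  constructor
  · intro h
    have h0 : (0 : ℂ) ∈ ball (0 : ℂ) R⁻¹ := mem_ball_self (inv_pos.2 hR)
    refine (analyticOnNhd_farIntegral hR hf κ hθ).eqOn_zero_of_preconnected_of_frequently_eq_zero
      (convex_ball 0 _).isPreconnected h0 ?_
    refine tendsto_inv_ofReal_nhdsNE.frequently (Eventually.frequently ?_)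
    filter_upwards [eventually_gt_atTop R] with ρ hρ
    have h1 := h ρ hρ
    rw [outgoingField_eq κ f hθ hρ] at h1
    have hρ0 : (ρ : ℂ) ≠ 0 := by exact_mod_cast (hR.trans hρ).ne'
    simpa [hρ0, Complex.exp_ne_zero] using h1
  · intro h ρ hρ
    rw [outgoingField_eq κ f hθ hρ, h, Pi.zero_apply, mul_zero]
    rw [mem_ball_zero_iff, Complex.norm_real, Real.norm_eq_abs,
      abs_of_pos (inv_pos.2 (hR.trans hρ))]
    gcongr

theorem outgoingField_eq_zero_iff_forall {κ R : ℝ} (hR : 0 < R) {f : E3 → ℂ}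
    (hf : IntegrableOn f (ballR R)) :
    (∀ x : E3, R < ‖x‖ → outgoingField κ R f x = 0) ↔
      ∀ θ : E3, ‖θ‖ = 1 → Set.EqOn (farIntegral κ R f θ) 0 (ball 0 R⁻¹) := by
  constructor
  · intro h θ hθ
    refine (farIntegral_eq_zero_iff hR hf hθ).1 fun ρ hρ => h _ ?_
    rwa [norm_ofReal_smul_unit hθ (hR.trans hρ)]
  · intro h x hx
    obtain ⟨θ, hθ, hxθ⟩ := exists_polar (norm_pos_iff.1 (hR.trans hx))
    rw [hxθ]
    exact (farIntegral_eq_zero_iff hR hf hθ).2 (h θ hθ) _ hx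

/-- A field that vanishes outside the ball for the outgoing kernel also vanishes there for the
incoming kernel, because `z ↦ -z` exchanges the two kernels near infinity. -/
theorem outgoingField_neg_eq_zero {κ R : ℝ} (hR : 0 < R) {f : E3 → ℂ}
    (hf : IntegrableOn f (ballR R)) (h : ∀ x : E3, R < ‖x‖ → outgoingField κ R f x = 0) :
    ∀ x : E3, R < ‖x‖ → outgoingField (-κ) R f x = 0 := by
  refine (outgoingField_eq_zero_iff_forall hR hf).2 fun θ hθ z hz => ?_
  have h1 := (outgoingField_eq_zero_iff_forall hR hf).1 h (-θ) (by simpa using hθ)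
    (show -z ∈ ball (0 : ℂ) R⁻¹ by simpa using hz)
  rw [farIntegral_neg, neg_neg] at h1
  exact h1

/-- If `e^{iκ/z} A(z) = e^{-iκ/z} B(z)` for small positive `z`, with `A` and `B` holomorphic near zero
and `κ > 0`, then `A = 0`: on the positive imaginary axis the equation makes `A` smaller than every
power of `z`. -/
theorem eqOn_zero_of_exp_mul_eq {κ r : ℝ} (hκ : 0 < κ) (hr : 0 < r) {A B : ℂ → ℂ}
    (hA : AnalyticOnNhd ℂ A (ball 0 r)) (hB : AnalyticOnNhd ℂ B (ball 0 r))
    (h : ∀ t : ℝ, 0 < t → t < r → Complex.exp (Complex.I * κ / t) * A t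
      = Complex.exp (-(Complex.I * κ / t)) * B t) :
    Set.EqOn A 0 (ball 0 r) := by
  have h0 : (0 : ℂ) ∈ ball (0 : ℂ) r := mem_ball_self hr
  -- A convex region that contains the positive real and the positive imaginary axis near zero.
  set S : Set ℂ := ball 0 r ∩ {z | 0 < z.re + z.im} with hS
  have hconv : Convex ℝ S := (convex_ball 0 r).inter
    (convex_halfSpace_gt (Complex.reLm + Complex.imLm).isLinear 0)
  have hne : ∀ z ∈ S, z ≠ 0 := by
    rintro z ⟨_, hz⟩ rfl
    simp at hz
  set F : ℂ → ℂ := fun z => Complex.exp (Complex.I * κ / z) * A z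
    - Complex.exp (-(Complex.I * κ / z)) * B z with hF
  have hFan : AnalyticOnNhd ℂ F S := by
    intro z hz
    have hdiv : AnalyticAt ℂ (fun z : ℂ => Complex.I * κ / z) z :=
      analyticAt_const.div analyticAt_id (hne z hz)
    exact (hdiv.cexp.mul (hA z hz.1)).sub (hdiv.neg.cexp.mul (hB z hz.1))
  have hreal : ∀ t : ℝ, 0 < t → t < r → (t : ℂ) ∈ S := by
    intro t h1 h2
    refine ⟨?_, by simpa using h1⟩
    rwa [mem_ball_zero_iff, Complex.norm_real, Real.norm_eq_abs, abs_of_pos h1]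
  have hFzero : Set.EqOn F 0 S := by
    refine hFan.eqOn_zero_of_preconnected_of_frequently_eq_zero hconv.isPreconnected
      (hreal (r / 2) (by linarith) (by linarith)) ?_
    have ht : Tendsto (fun t : ℝ => (t : ℂ)) (𝓝[≠] (r / 2)) (𝓝[≠] ((r / 2 : ℝ) : ℂ)) := by
      refine tendsto_nhdsWithin_iff.2
        ⟨(Complex.continuous_ofReal.tendsto _).mono_left nhdsWithin_le_nhds, ?_⟩
      filter_upwards [self_mem_nhdsWithin] with t ht
      exact fun h => ht (Complex.ofReal_injective h)
    refine ht.frequently (Eventually.frequently ?_)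
    filter_upwards [nhdsWithin_le_nhds (Ioo_mem_nhds (show 0 < r / 2 by linarith)
      (show r / 2 < r by linarith))] with t ht
    exact sub_eq_zero.2 (h t ht.1 ht.2)
  have himag : ∀ ε : ℝ, 0 < ε → ε < r → A (ε * Complex.I)
      = (Real.exp (-(2 * κ) / ε) : ℂ) * B (ε * Complex.I) := by
    intro ε h1 h2
    have hmem : (ε * Complex.I : ℂ) ∈ S := by
      refine ⟨?_, by simpa using h1⟩
      rw [mem_ball_zero_iff, norm_mul, Complex.norm_real, Complex.norm_I, mul_one,
        Real.norm_eq_abs, abs_of_pos h1]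
      exact h2
    have h3 := sub_eq_zero.1 (hFzero hmem)
    have hεc : (ε : ℂ) ≠ 0 := by exact_mod_cast h1.ne'
    have h4 : Complex.I * κ / (ε * Complex.I) = κ / ε := by
      rw [mul_comm (ε : ℂ), mul_div_mul_left _ _ Complex.I_ne_zero]
    rw [h4] at h3
    have h5 : Complex.exp (-(κ / ε : ℂ)) * Complex.exp (κ / ε : ℂ) = 1 := by
      rw [← Complex.exp_add]; simp
    have h6 : ((Real.exp (-(2 * κ) / ε) : ℝ) : ℂ)
        = Complex.exp (-(κ / ε : ℂ)) * Complex.exp (-(κ / ε : ℂ)) := by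
      rw [← Complex.exp_add]
      push_cast
      congr 1
      ring
    rw [h6]
    linear_combination Complex.exp (-(κ / ε : ℂ)) * h3 - A (ε * Complex.I) * h5
  by_contra hcon
  have hnev : ¬ ∀ᶠ z in 𝓝 0, A z = 0 := fun hev =>
    hcon (hA.eqOn_zero_of_preconnected_of_eventuallyEq_zero (convex_ball 0 r).isPreconnected h0 hev)
  obtain ⟨n, g, hg, hg0, hAg⟩ := (hA 0 h0).exists_eventuallyEq_pow_smul_nonzero_iff.2 hnev
  have htI : Tendsto (fun ε : ℝ => (ε * Complex.I : ℂ)) (𝓝[>] 0) (𝓝 0) := by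
    have : Continuous fun ε : ℝ => (ε * Complex.I : ℂ) := by fun_prop
    simpa using (this.tendsto 0).mono_left nhdsWithin_le_nhds
  have hdecay : Tendsto (fun ε : ℝ => Real.exp (-(2 * κ) / ε) / ε ^ n) (𝓝[>] 0) (𝓝 0) := by
    have h1 := (Real.tendsto_pow_mul_exp_neg_atTop_nhds_zero n).comp
      ((tendsto_inv_nhdsGT_zero (𝕜 := ℝ)).const_mul_atTop (show 0 < 2 * κ by linarith))
    have h2 := h1.const_mul (((2 * κ) ^ n)⁻¹)
    rw [mul_zero] at h2
    refine h2.congr' ?_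
    filter_upwards [self_mem_nhdsWithin] with ε hε
    have : ε ≠ 0 := ne_of_gt hε
    simp only [Function.comp, mul_pow, inv_pow]
    field_simp
  have hlim : Tendsto (fun ε : ℝ => ‖g (ε * Complex.I)‖) (𝓝[>] 0) (𝓝 0) := by
    have hBn : Tendsto (fun ε : ℝ => ‖B (ε * Complex.I)‖) (𝓝[>] 0) (𝓝 ‖B 0‖) :=
      ((hB 0 h0).continuousAt.tendsto.comp htI).norm
    have h3 := hdecay.mul hBn
    rw [zero_mul] at h3
    refine h3.congr' ?_
    filter_upwards [self_mem_nhdsWithin, htI.eventually hAg,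
      nhdsWithin_le_nhds (Iio_mem_nhds hr)] with ε hε hAε hεr
    have hε' : 0 < ε := hε
    rw [himag ε hε' hεr, sub_zero, smul_eq_mul] at hAε
    have h4 := congrArg norm hAε
    rw [norm_mul, norm_mul, norm_pow, norm_mul, Complex.norm_I, Complex.norm_real,
      Complex.norm_real, mul_one, Real.norm_eq_abs, Real.norm_eq_abs, abs_of_pos hε',
      abs_of_pos (Real.exp_pos _)] at h4
    rw [div_mul_eq_mul_div, h4]
    field_simp
  have hlim2 : Tendsto (fun ε : ℝ => ‖g (ε * Complex.I)‖) (𝓝[>] 0) (𝓝 ‖g 0‖) :=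
    (hg.continuousAt.tendsto.comp htI).norm
  exact hg0 (norm_eq_zero.1 (tendsto_nhds_unique hlim2 hlim))

/-- The outgoing field vanishes outside the ball if and only if the field of the regular kernel
`sin(κ|x - y|) / (κ|x - y|)` does. -/
theorem outgoingField_eq_zero_iff {κ R : ℝ} (hκ : 0 < κ) (hR : 0 < R) {f : E3 → ℂ}
    (hf : IntegrableOn f (ballR R)) :
    (∀ x : E3, R < ‖x‖ → outgoingField κ R f x = 0) ↔
      ∀ x : E3, R < ‖x‖ → translateIntegral R f (modeFn κ Complex.I 0 0) x = 0 := by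
  have hc : 2 * Complex.I * (κ : ℂ) ≠ 0 := by
    simp [Complex.I_ne_zero, hκ.ne']
  constructor
  · intro h x hx
    have h1 := outgoingField_sub (κ := κ) hf hx
    rw [h x hx, outgoingField_neg_eq_zero hR hf h x hx, sub_zero] at h1
    exact (mul_eq_zero.1 h1.symm).resolve_left hc
  · intro h
    refine (outgoingField_eq_zero_iff_forall hR hf).2 fun θ hθ => ?_
    refine eqOn_zero_of_exp_mul_eq hκ (inv_pos.2 hR) (analyticOnNhd_farIntegral hR hf κ hθ)
      (analyticOnNhd_farIntegral hR hf (-κ) hθ) fun t ht htR => ?_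
    have hρ : R < t⁻¹ := by rwa [lt_inv_comm₀ hR ht]
    have hx : R < ‖t⁻¹ • θ‖ := by rwa [norm_ofReal_smul_unit hθ (inv_pos.2 ht)]
    have h1 := outgoingField_sub (κ := κ) hf hx
    rw [h _ hx, mul_zero, sub_eq_zero, outgoingField_eq κ f hθ hρ,
      outgoingField_eq (-κ) f hθ hρ, inv_inv] at h1
    have htc : (t : ℂ) ≠ 0 := by exact_mod_cast ht.ne'
    push_cast at h1
    rw [inv_inv] at h1
    have e1 : Complex.I * κ / t = Complex.I * κ * (t : ℂ)⁻¹ := by rw [div_eq_mul_inv]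
    have e2 : -(Complex.I * κ / t) = Complex.I * -κ * (t : ℂ)⁻¹ := by
      rw [div_eq_mul_inv]; ring
    rw [e2, e1]
    refine mul_left_cancel₀ htc ?_
    linear_combination h1

/-! ### Divergence-free sources -/

theorem dyad_congr {κ : ℝ} {F G : E3 → ℂ} {y : E3} (h : F =ᶠ[𝓝 y] G) : dyad κ F y = dyad κ G y := by
  have h1 : ∀ s, pderiv s F =ᶠ[𝓝 y] pderiv s G := fun s =>
    h.fderiv.mono fun z hz => by rw [pderiv, hz, pderiv]
  ext l s
  simp only [dyad, Matrix.of_apply, h.eq_of_nhds]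
  rw [pderiv, (h1 s).fderiv_eq, pderiv]

theorem exists_smooth_compact_extension {R R' : ℝ} (hR : 0 < R) (hR' : R < R') {F : E3 → ℂ}
    (hF : ContDiffOn ℝ ∞ F (ball 0 R')) :
    ∃ G : E3 → ℂ, ContDiff ℝ ∞ G ∧ HasCompactSupport G ∧ ∀ y ∈ ballR R, F =ᶠ[𝓝 y] G := by
  let χ : ContDiffBump (0 : E3) := ⟨R, (R + R') / 2, hR, by linarith⟩
  refine ⟨fun y => (χ y : ℂ) * F y, ?_, ?_, fun y hy => ?_⟩
  · rw [contDiff_iff_contDiffAt]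
    intro y
    have hχ : ContDiff ℝ ∞ fun y => (χ y : ℂ) := contDiff_ofReal_comp χ.contDiff
    by_cases hy : y ∈ ball (0 : E3) R'
    · exact hχ.contDiffAt.mul (hF.contDiffAt (isOpen_ball.mem_nhds hy))
    · have hy2 : y ∈ (tsupport χ)ᶜ := by
        rw [χ.tsupport_eq]
        intro h
        rw [mem_closedBall] at h
        rw [mem_ball] at hy
        have : χ.rOut = (R + R') / 2 := rfl
        linarith
      have h0 : (fun y => (χ y : ℂ) * F y) =ᶠ[𝓝 y] fun _ => 0 := by
        filter_upwards [(isClosed_tsupport χ).isOpen_compl.mem_nhds hy2] with z hz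
        rw [image_eq_zero_of_notMem_tsupport hz]
        simp
      exact contDiffAt_const.congr_of_eventuallyEq h0
  · exact HasCompactSupport.mul_right (χ.hasCompactSupport.comp_left Complex.ofReal_zero)
  · filter_upwards [isOpen_ball.mem_nhds hy] with z hz
    rw [χ.one_of_mem_closedBall (ball_subset_closedBall hz)]
    simp

/-- Against a divergence-free source the term `∇∇F` of the dyad integrates to zero, since it is the
divergence pairing of the source with the test functions `∂_l F`. -/
theorem integral_dyad_mul {κ R R' : ℝ} (hR : 0 < R) (hR' : R < R') {J : E3 → C3}
    (hJ : ∀ l, IntegrableOn (fun y => J y l) (ballR R)) (hdiv : IsDivergenceFree R J)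
    {F : E3 → ℂ} (hF : ContDiffOn ℝ ∞ F (ball 0 R')) (l : Fin 3) :
    ∫ y in ballR R, ∑ s, dyad κ F y l s * J y s = ∫ y in ballR R, F y * J y l := by
  obtain ⟨G, hG, hGc, hFG⟩ := exists_smooth_compact_extension hR hR' hF
  have hη := contDiff_pderiv l hG
  have hηc : HasCompactSupport (pderiv l G) := hGc.fderiv_apply (𝕜 := ℝ) _
  have hz := hdiv _ hη hηc
  have i1 : IntegrableOn (fun y => G y * J y l) (ballR R) :=
    integrableOn_mul_of_continuousOn (hJ l) hG.continuous.continuousOn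
  have i2 : IntegrableOn (fun y => ∑ s, pderiv s (pderiv l G) y * J y s) (ballR R) :=
    integrable_finsetSum _ fun s _ => integrableOn_mul_of_continuousOn (hJ s)
      (contDiff_pderiv s hη).continuous.continuousOn
  have e1 : ∫ y in ballR R, F y * J y l = ∫ y in ballR R, G y * J y l :=
    setIntegral_congr_fun isOpen_ball.measurableSet fun y hy => by
      simp only [(hFG y hy).eq_of_nhds]
  have e2 : ∫ y in ballR R, ∑ s, dyad κ F y l s * J y s = ∫ y in ballR R, (G y * J y l
      + ((κ : ℂ) ^ 2)⁻¹ * ∑ s, pderiv s (pderiv l G) y * J y s) := by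
    refine setIntegral_congr_fun isOpen_ball.measurableSet fun y hy => ?_
    have hd : ∀ s, dyad κ F y l s = (if l = s then G y else 0)
        + ((κ : ℂ) ^ 2)⁻¹ * pderiv s (pderiv l G) y := fun s => by
      rw [dyad_congr (hFG y hy), dyad, Matrix.of_apply, pderiv_comm hG.contDiffAt]
    simp only [hd, add_mul, Finset.sum_add_distrib, ite_mul, zero_mul, Finset.sum_ite_eq,
      Finset.mem_univ, if_true, Finset.mul_sum, mul_assoc]
  rw [e1, e2, integral_add i1 (i2.const_mul _), integral_const_mul, hz, mul_zero, add_zero]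

theorem contDiff_multipole (κ : ℝ) {n : ℕ} {m : ℤ} (hm : m.natAbs ≤ n) :
    ContDiff ℝ ∞ (multipole κ n m) := by
  rw [funext (multipole_eq κ n m hm)]
  exact contDiff_const.mul (contDiff_modeFn _ _ _ _)

theorem contDiffOn_helmholtzGreen (κ : ℝ) (x : E3) :
    ContDiffOn ℝ ∞ (helmholtzGreen κ x) (ball 0 ‖x‖) := by
  intro y hy
  have hne : x - y ≠ 0 := by
    intro h
    rw [sub_eq_zero] at h
    rw [mem_ball_zero_iff, h] at hy
    exact lt_irrefl _ hy
  have hn : ContDiffAt ℝ ∞ (fun y => ‖x - y‖) y :=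
    (contDiffAt_const.sub contDiffAt_id).norm ℝ hne
  have hnc : ContDiffAt ℝ ∞ (fun y => (‖x - y‖ : ℂ)) y :=
    Complex.ofRealCLM.contDiff.contDiffAt.comp y hn
  have h0 : (4 * Real.pi * ‖x - y‖ : ℂ) ≠ 0 := by
    have := norm_ne_zero_iff.2 hne
    exact_mod_cast mul_ne_zero (mul_ne_zero four_ne_zero Real.pi_ne_zero) this
  have hden : ContDiffAt ℝ ∞ (fun y => (4 * Real.pi * ‖x - y‖ : ℂ)⁻¹) y :=
    (contDiffAt_const.mul hnc).inv h0
  exact ((contDiffAt_const.mul hnc).cexp.mul hden).contDiffWithinAt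

theorem electricField_eq {κ R : ℝ} (hR : 0 < R) {J : E3 → C3}
    (hJ : ∀ l, IntegrableOn (fun y => J y l) (ballR R)) (hdiv : IsDivergenceFree R J)
    {x : E3} (hx : R < ‖x‖) (l : Fin 3) :
    electricField κ R J x l
      = (4 * Real.pi : ℂ)⁻¹ * outgoingField κ R (fun y => J y l) x := by
  have h := integral_dyad_mul (κ := κ) hR hx hJ hdiv (contDiffOn_helmholtzGreen κ x) l
  rw [electricField, outgoingField, ← integral_const_mul]
  refine h.trans (setIntegral_congr_fun isOpen_ball.measurableSet fun y _ => ?_)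
  simp only [helmholtzGreen, div_eq_mul_inv, mul_inv]
  ring

theorem sphNorm_pos {n : ℕ} {m : ℤ} : 0 < sphNorm n m := by
  unfold sphNorm
  have := Real.pi_pos
  positivity

/-- The moments against the multipoles, over all degrees and orders, vanish together with the
moments against the functions `modeFn`. -/
theorem multipole_moments_eq_zero_iff {κ : ℝ} (hκ : 0 < κ) (R : ℝ) (f : E3 → ℂ) :
    (∀ (n : ℕ) (m : ℤ), m.natAbs ≤ n → ∫ y in ballR R, multipole κ n m y * f y = 0) ↔
      ∀ σ : ℂ, σ * σ = -1 → ∀ p d, ∫ y in ballR R, modeFn κ σ p d y * f y = 0 := by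
  have key : ∀ (n : ℕ) (m : ℤ), m.natAbs ≤ n →
      (∫ y in ballR R, multipole κ n m y * f y = 0 ↔
        ∫ y in ballR R, modeFn κ (orderSign m) m.natAbs (n - m.natAbs) y * f y = 0) := by
    intro n m hm
    have hc : ((κ ^ n * sphNorm n m * legendreLead m.natAbs : ℝ) : ℂ) ≠ 0 := by
      have h1 := sphNorm_pos (n := n) (m := m)
      have h2 := legendreLead_pos m.natAbs
      exact Complex.ofReal_ne_zero.2 (by positivity)
    simp only [multipole_eq κ n m hm, mul_assoc (Complex.ofReal _)]
    rw [integral_const_mul, mul_eq_zero, or_iff_right hc]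
  have horder : ∀ m : ℤ, orderSign m * orderSign m = -1 := fun m => by
    unfold orderSign; split_ifs <;> simp
  constructor
  · intro h σ hσ p d
    obtain ⟨m, hm, hmσ⟩ : ∃ m : ℤ, m.natAbs = p ∧ modeFn κ (orderSign m) p d = modeFn κ σ p d := by
      rcases p with _ | p
      · exact ⟨0, rfl, by ext y; simp [modeFn]⟩
      · rcases mul_self_eq_mul_self_iff.1 (hσ.trans Complex.I_mul_I.symm) with rfl | rfl
        · refine ⟨-(p + 1 : ℕ), by omega, ?_⟩
          rw [orderSign, if_neg (by push_cast; omega)]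
        · refine ⟨(p + 1 : ℕ), by omega, ?_⟩
          rw [orderSign, if_pos (by positivity)]
    have h1 := (key (p + d) m (by omega)).1 (h _ _ (by omega))
    rw [hm, Nat.add_sub_cancel_left, hmσ] at h1
    exact h1
  · intro h n m hm
    exact (key n m hm).2 (h _ (horder m) _ _)

end Maxwell

open Maxwell in
theorem proposition3p2 (κ R : ℝ) (hκ : 0 < κ) (hR : 0 < R) (J : Maxwell.E3 → Maxwell.C3)
    (hJ : MemLp J 2 (volume.restrict (Maxwell.ballR R)))
    (hdiv : Maxwell.IsDivergenceFree R J) :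
    (∀ (n : ℕ) (m : ℤ), m.natAbs ≤ n → Maxwell.beta κ R J n m = Maxwell.alpha κ R J n m) ∧
    (Maxwell.IsNonradiating κ R J ↔
      ∀ (n : ℕ) (m : ℤ), m.natAbs ≤ n → Maxwell.alpha κ R J n m = 0) := by
  have hfin : IsFiniteMeasure (volume.restrict (ballR R)) :=
    ⟨by rw [Measure.restrict_apply_univ]; exact measure_ball_lt_top⟩
  have hJi : Integrable J (volume.restrict (ballR R)) := hJ.integrable (by norm_num)
  have hJl : ∀ l, IntegrableOn (fun y => J y l) (ballR R) := fun l =>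
    (EuclideanSpace.proj (𝕜 := ℂ) l).integrable_comp hJi
  refine ⟨fun n m hm => funext fun l => ?_, ?_⟩
  · exact integral_dyad_mul hR (lt_add_one R) hJl hdiv (contDiff_multipole κ hm).contDiffOn l
  · have hscalar : ∀ l, (∀ x : E3, R < ‖x‖ → outgoingField κ R (fun y => J y l) x = 0) ↔
        ∀ (n : ℕ) (m : ℤ), m.natAbs ≤ n → alpha κ R J n m l = 0 := fun l =>
      (outgoingField_eq_zero_iff hκ hR (hJl l)).trans
        ((moments_eq_zero_iff (hJl l) hκ.ne').symm.trans
          (multipole_moments_eq_zero_iff hκ R _).symm)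
    have hpi : (4 * Real.pi : ℂ)⁻¹ ≠ 0 := by simp [Real.pi_ne_zero]
    constructor
    · intro h n m hm
      ext l
      refine (hscalar l).1 (fun x hx => ?_) n m hm
      have h1 := congrFun (h x hx) l
      rw [electricField_eq hR hJl hdiv hx] at h1
      exact (mul_eq_zero.1 h1).resolve_left hpi
    · intro h x hx
      ext l
      rw [electricField_eq hR hJl hdiv hx,
        (hscalar l).2 (fun n m hm => congrFun (h n m hm) l) x hx, mul_zero, Pi.zero_apply]
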